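/- Let $d\ge 1$ and $m\ge 0$, with $m>0$ or $d\ge 2$. Write points of Minkowski spacetime as $x=(x_0,\mathbf x)\in\mathbb R^{d+1}$, put $p\cdot x=p_0x_0-\mathbf p\cdot\mathbf x$, $p^2=p\cdot p$, $\omega(\mathbf p)=\sqrt{\mathbf p^2+m^2}$, and normalize the Fourier transform by $\hat f(p)=(2\pi)^{-(d+1)/2}\int f(x)e^{ip\cdot x}\,dx$, extended to tempered distributions by duality. Let $\delta(p^2-m^2)$ be the measure on $\mathfrak H_m\cup-\mathfrak H_m$, $\mathfrak H_m=\{p: p^2=m^2,\ p_0\ge 0\}$, which is $d\mathbf p/2\omega(\mathbf p)$ on each of the two sheets $p_0=\pm\omega(\mathbf p)$, let $d\Omega_m$ be its restriction to $\mathfrak H_m$, and let $\mathcal H=L^2(\mathfrak H_m,d\Omega_m)$. Let $\bar{\mathcal T}$ be the space of real tempered distributions $\Phi$ on $\mathbb R^{d+1}$ with $\hat\Phi(p)=C(p)\,\delta(p^2-m^2)$ for a Borel function $C$ with $\int |C(p)|^2\delta(p^2-m^2)\,dp<\infty$; these are solutions of the Klein–Gordon equation $(\square+m^2)\Phi=0$.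 For such $\Phi$ put $[\Phi]=\sqrt{2\pi}\,C|_{\mathfrak H_m}\in\mathcal H$, and let its Cauchy data at time zero be the real tempered distributions on $\mathbb R^d$ given by $$\Phi_0(\mathbf x)=(2\pi)^{-\frac{d+1}2}\,\Re\int C(\omega(\mathbf p),\mathbf p)\,e^{i\mathbf x\cdot\mathbf p}\,\frac{d\mathbf p}{\omega(\mathbf p)},\qquad \Phi_0'(\mathbf x)=(2\pi)^{-\frac{d+1}2}\,\Im\int C(\omega(\mathbf p),\mathbf p)\,e^{i\mathbf x\cdot\mathbf p}\,d\mathbf p .$$ Let $W=\{x\in\mathbb R^{d+1}: x_1>|x_0|\}$ and let $H(W)$ be the closed real linear subspace of $\mathcal H$ generated by the vectors $i\sqrt{2\pi}\,\hat f|_{\mathfrak H_m}$, where $f$ runs through the real smooth functions with compact support contained in $W$. (Up to a real constant, $i\sqrt{2\pi}\,\hat f|_{\mathfrak H_m}$ is the vector of the real wave $f\star D$, where $D$ is the real commutator function, $\hat D(p)=\pm i\,\delta(p^2-m^2)$ for $\pm p_0\ge 0$.) **Proposition.** If $\Phi\in\bar{\mathcal T}$, then $[\Phi]$ belongs to $H(W)$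 if and only if both $\mathrm{supp}(\Phi_0)$ and $\mathrm{supp}(\Phi_0')$ are contained in the half-space $x_1\ge 0$. -/

import Mathlib

open MeasureTheory Complex
open scoped SchwartzMap FourierTransform ContDiff ENNReal

noncomputable section

namespace KleinGordon

/-- Physical space at a fixed time; the coordinate `x₁` of a point `x` is `x 0`. -/
abbrev Space (d : ℕ) := EuclideanSpace ℝ (Fin d)

/-- Minkowski spacetime; `x 0` is the time coordinate and `x j.succ` are the space coordinates. The
same type is used for energy-momentum vectors. -/
abbrev Spacetime (d : ℕ) := EuclideanSpace ℝ (Fin (d + 1))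

/-- The point of spacetime with time coordinate `t` and space part `x`. -/
def event {d : ℕ} (t : ℝ) (x : Space d) : Spacetime d :=
  WithLp.toLp 2 (Fin.cons t (fun j => x j))

/-- The Lorentz product, of signature `(+, -, …, -)`. -/
def lorentz {d : ℕ} (p x : Spacetime d) : ℝ :=
  p 0 * x 0 - ∑ j : Fin d, p j.succ * x j.succ

/-- The energy `ω(p) = √(p² + m²)` of a particle of mass `m` and momentum `p`. -/
def energy {d : ℕ} (m : ℝ) (p : Space d) : ℝ := √(‖p‖ ^ 2 + m ^ 2)

/-! ### Mass shell and one-particle space -/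

/-- The measure `dp / 2ω(p)` on momentum space. -/
def momentumMeasure (d : ℕ) (m : ℝ) : Measure (Space d) :=
  volume.withDensity fun p => ENNReal.ofReal (1 / (2 * energy m p))

/-- The Lorentz invariant measure `dΩ_m`, that is `δ(p² - m²)` on the positive hyperboloid
`{p | p² = m², p₀ ≥ 0}`. -/
def posShell (d : ℕ) (m : ℝ) : Measure (Spacetime d) :=
  (momentumMeasure d m).map fun p => event (energy m p) p

/-- The measure `δ(p² - m²)` on the negative hyperboloid `{p | p² = m², p₀ ≤ 0}`. -/
def negShell (d : ℕ) (m : ℝ) : Measure (Spacetime d) :=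
  (momentumMeasure d m).map fun p => event (-energy m p) p

/-- The measure `δ(p² - m²)`. -/
def shell (d : ℕ) (m : ℝ) : Measure (Spacetime d) := posShell d m + negShell d m

/-- The one-particle Hilbert space: the square integrable functions on the positive hyperboloid. -/
abbrev OneParticle (d : ℕ) (m : ℝ) := Lp ℂ 2 (posShell d m)

/-! ### The Fourier transform with respect to the Lorentz product -/

/-- The normalization constant `(2π)^{-(d+1)/2}` of the Fourier transform on spacetime. -/
def fourierConst (d : ℕ) : ℝ := (2 * Real.pi) ^ (-((d : ℝ) + 1) / 2)

/-- `f̂(p) = (2π)^{-(d+1)/2} ∫ f(x) e^{ip·x} dx`, with the Lorentz product `p·x`. -/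
def lorentzFourier {d : ℕ} (f : Spacetime d → ℂ) (p : Spacetime d) : ℂ :=
  (fourierConst d : ℂ) * ∫ x, f x * exp (I * (lorentz p x : ℂ))

/-- Multiplication of each coordinate by a nonzero scalar: `-1/2π` in the time direction and
`1/2π` in the space directions. It converts `exp (-2πi ⟪x, ·⟫)` into `exp (i · )` of the Lorentz
product with `x`. -/
def rescale (d : ℕ) : Spacetime d ≃L[ℝ] Spacetime d :=
  ((EuclideanSpace.equiv (Fin (d + 1)) ℝ).trans
    (ContinuousLinearEquiv.piCongrRight fun i : Fin (d + 1) =>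
      ContinuousLinearEquiv.smulLeft
        (if i = 0 then Units.mk0 (-(2 * Real.pi)⁻¹) (neg_ne_zero.mpr (by positivity))
          else Units.mk0 ((2 * Real.pi)⁻¹) (by positivity)))).trans
    (EuclideanSpace.equiv (Fin (d + 1)) ℝ).symm

/-- `lorentzFourier` as a continuous linear map of the Schwartz space
(see `schwartzFourier_apply`). -/
def schwartzFourier (d : ℕ) : 𝓢(Spacetime d, ℂ) →L[ℂ] 𝓢(Spacetime d, ℂ) :=
  (fourierConst d : ℂ) •
    (SchwartzMap.compCLMOfContinuousLinearEquiv ℂ (rescale d)).comp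
      (FourierTransform.fourierCLM ℂ 𝓢(Spacetime d, ℂ))

theorem rescale_apply {d : ℕ} (x : Spacetime d) (i : Fin (d + 1)) :
    rescale d x i = (if i = 0 then -(2 * Real.pi)⁻¹ else (2 * Real.pi)⁻¹) * x i := by
  have h : rescale d x i = (if i = 0 then
      Units.mk0 (-(2 * Real.pi)⁻¹) (neg_ne_zero.mpr (by positivity))
      else Units.mk0 ((2 * Real.pi)⁻¹) (by positivity) : ℝˣ) • x i := rfl
  rw [h]
  split_ifs <;> rfl

theorem schwartzFourier_apply {d : ℕ} (f : 𝓢(Spacetime d, ℂ)) (p : Spacetime d) :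
    schwartzFourier d f p = lorentzFourier f p := by
  have h1 : schwartzFourier d f p = (fourierConst d : ℂ) * (𝓕 (f : Spacetime d → ℂ)) (rescale d p) := by
    rfl
  rw [h1, lorentzFourier, Real.fourier_eq']
  congr 1
  refine integral_congr_ae (Filter.Eventually.of_forall fun x => ?_)
  have h2 : -2 * Real.pi * inner ℝ x (rescale d p) = lorentz p x := by
    have hpi := Real.pi_ne_zero
    simp only [PiLp.inner_apply, lorentz, Fin.sum_univ_succ, rescale_apply, Fin.succ_ne_zero,
      if_true, if_false, RCLike.inner_apply, conj_trivial, mul_add, Finset.mul_sum]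
    rw [sub_eq_add_neg, ← Finset.sum_neg_distrib]
    congr 1
    · field_simp
    · refine Finset.sum_congr rfl fun j _ => ?_
      field_simp
  simp only [h2, smul_eq_mul]
  rw [mul_comm, mul_comm I]

/-- The Fourier transform of a tempered distribution, defined by duality. -/
def distFourier {d : ℕ} (Φ : 𝓢'(Spacetime d, ℂ)) : 𝓢'(Spacetime d, ℂ) :=
  PointwiseConvergenceCLM.precomp ℂ (schwartzFourier d) Φ

/-! ### Waves -/

/-- `Φ` is a tempered distribution in the space `𝒯̄`, with `Φ̂(p) = C(p) δ(p² - m²)`: it is real, and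
`C` is a Borel function, square integrable with respect to `δ(p² - m²)`. -/
structure IsWave {d : ℕ} (m : ℝ) (Φ : 𝓢'(Spacetime d, ℂ)) (C : Spacetime d → ℂ) : Prop where
  real : ∀ f : 𝓢(Spacetime d, ℂ), (∀ x, (f x).im = 0) → (Φ f).im = 0
  borel : Measurable C
  memLp : MemLp C 2 (shell d m)
  fourier : ∀ f : 𝓢(Spacetime d, ℂ), distFourier Φ f = ∫ p, C p * f p ∂(shell d m)

theorem IsWave.memLp_vector {d : ℕ} {m : ℝ} {Φ : 𝓢'(Spacetime d, ℂ)} {C : Spacetime d → ℂ}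
    (h : IsWave m Φ C) : MemLp (fun p => (√(2 * Real.pi) : ℂ) * C p) 2 (posShell d m) :=
  (h.memLp.mono_measure (Measure.le_add_right le_rfl)).const_mul _

/-- The vector `[Φ] = √(2π) Φ̂ |_{p₀ ≥ 0}` of the one-particle space. -/
def IsWave.vector {d : ℕ} {m : ℝ} {Φ : 𝓢'(Spacetime d, ℂ)} {C : Spacetime d → ℂ}
    (h : IsWave m Φ C) : OneParticle d m :=
  h.memLp_vector.toLp _

/-- The time-zero value
`Φ₀(x) = (2π)^{-(d+1)/2} Re ∫ C(ω(p), p) e^{ix·p} dp / ω(p)`, as a distribution. -/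
def cauchyValue {d : ℕ} (m : ℝ) (C : Spacetime d → ℂ) (g : 𝓢(Space d, ℝ)) : ℝ :=
  fourierConst d * (∫ p : Space d, C (event (energy m p) p) *
    (∫ x : Space d, (g x : ℂ) * exp (I * (inner ℝ x p : ℂ))) / (energy m p : ℂ)).re

/-- The time-zero time derivative
`Φ₀'(x) = (2π)^{-(d+1)/2} Im ∫ C(ω(p), p) e^{ix·p} dp`, as a distribution. -/
def cauchyDeriv {d : ℕ} (m : ℝ) (C : Spacetime d → ℂ) (g : 𝓢(Space d, ℝ)) : ℝ :=
  fourierConst d * (∫ p : Space d, C (event (energy m p) p) *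
    (∫ x : Space d, (g x : ℂ) * exp (I * (inner ℝ x p : ℂ)))).im

/-! ### Local subspaces -/

/-- The vectors of the real waves `f ⋆ D` generated by real test functions `f` supported in `O`.
Here `D` is the real commutator function, whose Fourier transform is, up to a positive constant,
`± i δ(p² - m²)` for `± p₀ ≥ 0`, so that on the positive hyperboloid the vector of `f ⋆ D` is
`√(2π) i f̂` up to a positive constant. -/
def testVectors (d : ℕ) (m : ℝ) (O : Set (Spacetime d)) : Set (OneParticle d m) :=
  {v | ∃ f : Spacetime d → ℝ, ContDiff ℝ ∞ f ∧ HasCompactSupport f ∧ tsupport f ⊆ O ∧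
    v =ᵐ[posShell d m]
      fun p => (√(2 * Real.pi) : ℂ) * (I * lorentzFourier (fun x => (f x : ℂ)) p)}

/-- `H(O)`: the closed real linear subspace generated by the vectors localized in `O`. -/
def localSubspace (d : ℕ) (m : ℝ) (O : Set (Spacetime d)) : Submodule ℝ (OneParticle d m) :=
  (Submodule.span ℝ (testVectors d m O)).topologicalClosure

/-- The wedge `W = {x | x₁ > |x₀|}`. -/
def wedge (d : ℕ) [NeZero d] : Set (Spacetime d) := {x | |x 0| < x (Fin.succ (0 : Fin d))}

/-- The half-space `x₁ ≥ 0`. -/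
def halfSpace (d : ℕ) [NeZero d] : Set (Space d) := {x | 0 ≤ x 0}

end KleinGordon

end

open KleinGordon

noncomputable section

namespace KleinGordon

open Filter Topology
open scoped ComplexConjugate

/-! ### Splitting off a coordinate -/

/-! Both directions rest on the real-linear pairing between time-zero data and vectors. By
`cauchyValue_eq_inner` and `cauchyDeriv_eq_inner`, the data tested with `g` are, up to positive
constants, `Re ⟪valueSymbol g, C⟫` and `Im ⟪derivSymbol g, C⟫`, so they are continuous real
functionals of the vector.

If the vector lies in `H(W)`, it is enough that these functionals vanish on the generators when `g`
is supported in `x₁ < 0`. This is Einstein causality, `im_integral_commutatorDensity`. With `p₁ = μ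
sinh θ`, where `μ` is the energy of the transverse momentum `q`, the measure `dp₁/2ω` becomes
`dθ/2`, and for `x ∈ W`, `y₁ ≤ 0` the factor `exp(ip·(x-y))` stays bounded for `-π ≤ Im θ ≤ 0`.
Shifting the contour to `Im θ = -π` reverses `ω` and `p₁`, which amounts to complex conjugation
together with `q ↦ -q`. Integration over `q` therefore gives a real number.

Conversely, by Hahn–Banach and Riesz (`mem_localSubspace_of_re_inner`) it is enough that every `V`
real orthogonal to the generators is real orthogonal to `C`. Put `c = C/√ω` and `u = conj V/√ω`.
Then `Re ∫ uc` splits into a pairing of Hermitian parts and a pairing of anti-Hermitian parts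
(`re_integral_mul_eq`). The support of the Cauchy data confines the transforms of `hermitianPart
c/√ω` and `skewPart c·√ω` to one half-space; orthogonality to test functions in `W` and to their
time derivatives confines those of `hermitianPart u·√ω` and `skewPart u/√ω` to the opposite one. In
each pairing the weights `√ω` and `1/√ω` cancel, and the pairing vanishes by Plancherel
(`integral_mul_eq_zero_of_halfSpaces`). Mollification by bumps shifted off the common boundary makes
the transforms functions and separates their supports; a further multiplier tames `1/√ω` at zero
momentum. -/

/-- The space part of a point of spacetime. -/
def spatial (d : ℕ) : Spacetime d →L[ℝ] Space d :=
  LinearMap.toContinuousLinearMap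
    { toFun := fun x => WithLp.toLp 2 fun j => x j.succ
      map_add' := fun _ _ => rfl
      map_smul' := fun _ _ => rfl }

@[simp] theorem spatial_apply {d : ℕ} (x : Spacetime d) (j : Fin d) :
    spatial d x j = x j.succ := rfl

@[simp] theorem event_zero {d : ℕ} (t : ℝ) (x : Space d) : event t x 0 = t := rfl

@[simp] theorem event_succ {d : ℕ} (t : ℝ) (x : Space d) (j : Fin d) :
    event t x j.succ = x j := rfl

@[simp] theorem spatial_event {d : ℕ} (t : ℝ) (x : Space d) : spatial d (event t x) = x := rfl

@[simp] theorem event_spatial {d : ℕ} (x : Spacetime d) : event (x 0) (spatial d x) = x := by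
  ext j
  refine Fin.cases rfl (fun i => rfl) j

theorem continuous_event {d : ℕ} : Continuous fun z : ℝ × Space d => event z.1 z.2 := by
  refine (PiLp.continuous_toLp 2 _).comp (continuous_pi fun j => ?_)
  refine Fin.cases ?_ (fun i => ?_) j
  · simpa using continuous_fst
  · simp only [Fin.cons_succ]
    fun_prop

/-- `Spacetime n` and `Space (n + 1)` are the same type, so the same splitting separates time from
space and, later, the first momentum component from the transverse ones. -/
theorem measurePreserving_event (d : ℕ) :
    MeasurePreserving (fun z : ℝ × Space d => event z.1 z.2) := by
  have h1 : MeasurePreserving (fun z : ℝ × Space d => (z.1, WithLp.ofLp z.2))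
      (volume : Measure (ℝ × Space d)) (volume : Measure (ℝ × (Fin d → ℝ))) :=
    (MeasurePreserving.id volume).prod
      (EuclideanSpace.volume_preserving_symm_measurableEquiv_toLp (Fin d))
  have h2 := (volume_preserving_piFinSuccAbove (fun _ : Fin (d + 1) => ℝ) 0).symm
  have h3 := (EuclideanSpace.volume_preserving_symm_measurableEquiv_toLp (Fin (d + 1))).symm
  convert! h3.comp (h2.comp h1) using 1
  funext z
  ext j
  refine Fin.cases ?_ (fun i => ?_) j
  · simp [MeasurableEquiv.piFinSuccAbove_symm_apply, Fin.insertNthEquiv]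
  · simp [MeasurableEquiv.piFinSuccAbove_symm_apply, Fin.insertNthEquiv]

theorem measurableEmbedding_event (d : ℕ) :
    MeasurableEmbedding fun z : ℝ × Space d => event z.1 z.2 := by
  refine continuous_event.measurable.measurableEmbedding fun z w h => ?_
  have h0 : z.1 = w.1 := congrArg (fun x : Spacetime d => x 0) h
  have h1 : z.2 = w.2 := congrArg (spatial d) h
  exact Prod.ext h0 h1

theorem integral_event {d : ℕ} {E : Type*} [NormedAddCommGroup E] [NormedSpace ℝ E]
    (F : Spacetime d → E) :
    ∫ x, F x = ∫ z : ℝ × Space d, F (event z.1 z.2) :=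
  ((measurePreserving_event d).integral_comp (measurableEmbedding_event d) F).symm

theorem integrable_event {d : ℕ} {E : Type*} [NormedAddCommGroup E]
    {F : Spacetime d → E} :
    Integrable (fun z : ℝ × Space d => F (event z.1 z.2)) ↔ Integrable F :=
  (measurePreserving_event d).integrable_comp_emb (measurableEmbedding_event d)

theorem norm_event_sq {d : ℕ} (t : ℝ) (x : Space d) : ‖event t x‖ ^ 2 = t ^ 2 + ‖x‖ ^ 2 := by
  simp [EuclideanSpace.norm_sq_eq, Fin.sum_univ_succ]

/-! ### The energy -/

section energy

variable {d : ℕ} {m : ℝ}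

theorem energy_nonneg (m : ℝ) (p : Space d) : 0 ≤ energy m p := Real.sqrt_nonneg _

theorem continuous_energy (m : ℝ) : Continuous (energy m : Space d → ℝ) := by
  unfold energy
  fun_prop

@[fun_prop] theorem measurable_energy (m : ℝ) : Measurable (energy m : Space d → ℝ) :=
  (continuous_energy m).measurable

@[simp] theorem energy_neg (m : ℝ) (p : Space d) : energy m (-p) = energy m p := by
  simp [energy]

theorem energy_sq (m : ℝ) (p : Space d) : energy m p ^ 2 = ‖p‖ ^ 2 + m ^ 2 :=
  Real.sq_sqrt (by positivity)

theorem norm_le_energy (m : ℝ) (p : Space d) : ‖p‖ ≤ energy m p :=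
  Real.le_sqrt_of_sq_le (by nlinarith [sq_nonneg m])

theorem mass_le_energy (m : ℝ) (p : Space d) : m ≤ energy m p :=
  Real.le_sqrt_of_sq_le (by nlinarith [sq_nonneg ‖p‖])

theorem energy_le (m : ℝ) (p : Space d) : energy m p ≤ ‖p‖ + |m| := by
  refine Real.sqrt_le_iff.2 ⟨by positivity, ?_⟩
  nlinarith [mul_nonneg (norm_nonneg p) (abs_nonneg m), sq_abs m]

theorem energy_pos_of_mass (hm : 0 < m) (p : Space d) : 0 < energy m p :=
  hm.trans_le (mass_le_energy m p)

theorem energy_pos_of_ne {p : Space d} (hp : p ≠ 0) : 0 < energy m p :=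
  (norm_pos_iff.2 hp).trans_le (norm_le_energy m p)

theorem ae_energy_pos [NeZero d] (m : ℝ) : ∀ᵐ p : Space d, 0 < energy m p := by
  have : (volume : Measure (Space d)) {0} = 0 := measure_singleton 0
  filter_upwards [compl_mem_ae_iff.2 this] with p hp
  exact energy_pos_of_ne hp

theorem ae_energy_pos' (h : 0 < m ∨ 1 ≤ d) : ∀ᵐ p : Space d, 0 < energy m p := by
  rcases h with h | h
  · exact .of_forall fun p => energy_pos_of_mass h p
  · have : NeZero d := ⟨by omega⟩
    exact ae_energy_pos m

/-- Rapidly decreasing functions are integrable against `dp / ω(p)`. -/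
theorem integrable_decay_div_energy (hmd : 0 < m ∨ 2 ≤ d) :
    Integrable fun p : Space d => (1 + ‖p‖) ^ (-((d : ℝ) + 1)) / energy m p := by
  have hb : Integrable fun p : Space d => (1 + ‖p‖) ^ (-((d : ℝ) + 1)) :=
    integrable_one_add_norm (by simp)
  have hpos : ∀ p : Space d, 0 ≤ (1 + ‖p‖) ^ (-((d : ℝ) + 1)) := fun p => by positivity
  have hmeas : AEStronglyMeasurable
      (fun p : Space d => (1 + ‖p‖) ^ (-((d : ℝ) + 1)) / energy m p) volume := by
    refine Measurable.aestronglyMeasurable ?_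
    exact (((measurable_const.add measurable_norm).pow_const _)).div (measurable_energy m)
  rcases hmd with hm | hd
  · refine (hb.div_const m).mono' hmeas (.of_forall fun p => ?_)
    rw [Real.norm_of_nonneg (div_nonneg (hpos p) (energy_nonneg m p))]
    exact div_le_div_of_nonneg_left (hpos p) hm (mass_le_energy m p)
  · have : NeZero d := ⟨by omega⟩
    -- Without a positive mass only `1/ω ≤ 1/‖p‖` is available. In polar coordinates the Jacobian `y
    -- ^ (d - 1)` absorbs the singularity because `d ≥ 2`.
    have key : Integrable fun p : Space d => (1 + ‖p‖) ^ (-((d : ℝ) + 1)) / ‖p‖ := by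
      rw [integrable_fun_norm_addHaar volume
        (f := fun y : ℝ => (1 + y) ^ (-((d : ℝ) + 1)) / y)]
      have h1 : Integrable fun y : ℝ => (1 + ‖y‖) ^ (-(2 : ℝ)) :=
        integrable_one_add_norm (by simp)
      refine h1.integrableOn.mono' ?_ ?_
      · refine Measurable.aestronglyMeasurable ?_
        fun_prop
      · filter_upwards [ae_restrict_mem measurableSet_Ioi] with y hy
        have hy : 0 < y := hy
        obtain ⟨k, rfl⟩ : ∃ k, d = k + 2 := ⟨d - 2, by omega⟩
        have e1 : (1 + y) ^ (-(((k + 2 : ℕ) : ℝ) + 1)) = (1 + y) ^ (-(2 : ℝ)) * ((1 + y) ^ (k + 1))⁻¹ := by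
          rw [← Real.rpow_natCast, ← Real.rpow_neg (by positivity), ← Real.rpow_add (by positivity)]
          congr 1; push_cast; ring
        have e2 : y ^ (Module.finrank ℝ (Space (k + 2)) - 1) = y ^ k * y := by
          simp [pow_succ]
        rw [e1, e2, smul_eq_mul, Real.norm_of_nonneg hy.le, Real.norm_of_nonneg (by positivity)]
        have e3 : y ^ k * y * ((1 + y) ^ (-(2 : ℝ)) * ((1 + y) ^ (k + 1))⁻¹ / y)
            = (1 + y) ^ (-(2 : ℝ)) * (y ^ k / (1 + y) ^ (k + 1)) := by
          field_simp
        rw [e3]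
        refine mul_le_of_le_one_right (by positivity) ?_
        rw [div_le_one (by positivity)]
        calc y ^ k ≤ (1 + y) ^ k := by gcongr; linarith
          _ ≤ (1 + y) ^ (k + 1) := pow_le_pow_right₀ (by linarith) (by omega)
    refine key.mono' hmeas ?_
    have : (volume : Measure (Space d)) {0} = 0 := measure_singleton 0
    filter_upwards [compl_mem_ae_iff.2 this] with p hp
    rw [Real.norm_of_nonneg (div_nonneg (hpos p) (energy_nonneg m p))]
    exact div_le_div_of_nonneg_left (hpos p) (norm_pos_iff.2 hp) (norm_le_energy m p)

end energy

/-! ### Integration over the mass shell -/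

section shell

variable {d : ℕ} {m : ℝ}

theorem measurableEmbedding_posShell (d : ℕ) (m : ℝ) :
    MeasurableEmbedding fun p : Space d => event (energy m p) p := by
  refine (continuous_event.comp ((continuous_energy m).prodMk continuous_id)).measurable.measurableEmbedding
    fun p q h => ?_
  exact congrArg (spatial d) h

theorem integral_posShell {E : Type*} [NormedAddCommGroup E] [NormedSpace ℝ E]
    (F : Spacetime d → E) :
    ∫ k, F k ∂posShell d m = ∫ p : Space d, (1 / (2 * energy m p)) • F (event (energy m p) p) := by
  rw [posShell, (measurableEmbedding_posShell d m).integral_map, momentumMeasure,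
    integral_withDensity_eq_integral_toReal_smul (by fun_prop) (by simp)]
  refine integral_congr_ae (.of_forall fun p => ?_)
  have := energy_nonneg m p
  simp only
  rw [ENNReal.toReal_ofReal (by positivity)]

theorem integrable_posShell_iff {E : Type*} [NormedAddCommGroup E] [NormedSpace ℝ E]
    (F : Spacetime d → E) :
    Integrable F (posShell d m) ↔
      Integrable fun p : Space d => (1 / (2 * energy m p)) • F (event (energy m p) p) := by
  rw [posShell, (measurableEmbedding_posShell d m).integrable_map_iff, momentumMeasure,
    integrable_withDensity_iff_integrable_smul' (by fun_prop) (by simp)]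
  refine integrable_congr (.of_forall fun p => ?_)
  have := energy_nonneg m p
  simp only [Function.comp]
  rw [ENNReal.toReal_ofReal (by positivity)]

/-- A square integrable function on the mass shell, multiplied by `ω^{-1/2}`, is square integrable
with respect to Lebesgue measure. -/
theorem memLp_div_sqrt_energy {c : Spacetime d → ℂ} (hc : Measurable c)
    (h : MemLp c 2 (posShell d m)) :
    MemLp (fun p : Space d => c (event (energy m p) p) / (√(energy m p) : ℂ)) 2 := by
  have hmeas : Measurable fun p : Space d => c (event (energy m p) p) / (√(energy m p) : ℂ) := by
    have := (measurableEmbedding_posShell d m).measurable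
    exact (hc.comp this).div (by fun_prop)
  rw [memLp_two_iff_integrable_sq_norm hmeas.aestronglyMeasurable]
  rw [memLp_two_iff_integrable_sq_norm hc.aestronglyMeasurable, integrable_posShell_iff] at h
  refine (h.const_mul 2).congr (.of_forall fun p => ?_)
  have := energy_nonneg m p
  simp only [norm_div, norm_real, Real.norm_of_nonneg (Real.sqrt_nonneg (energy m p)), div_pow,
    Real.sq_sqrt this, smul_eq_mul]
  rw [one_div, mul_inv]
  ring

theorem memLp_posShell_of_integrable {c : Spacetime d → ℂ} (hc : Measurable c)
    (h : Integrable fun p : Space d => ‖c (event (energy m p) p)‖ ^ 2 / energy m p) :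
    MemLp c 2 (posShell d m) := by
  rw [memLp_two_iff_integrable_sq_norm hc.aestronglyMeasurable, integrable_posShell_iff]
  refine (h.const_mul (1 / 2)).congr (.of_forall fun p => ?_)
  simp only [smul_eq_mul]
  rw [one_div, one_div, mul_inv]
  ring

end shell

/-! ### Plancherel -/

section Plancherel

variable {E : Type*} [NormedAddCommGroup E] [InnerProductSpace ℝ E] [FiniteDimensional ℝ E]
  [MeasurableSpace E] [BorelSpace E]

/-- The Fourier transform on `L²` is given by the Fourier integral on `L¹ ∩ L²`. -/
theorem fourier_toLp_ae_eq {f : E → ℂ} (h1 : Integrable f) (h2 : MemLp f 2) :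
    (𝓕 (h2.toLp f) : Lp ℂ 2 (volume : Measure E)) =ᵐ[volume] 𝓕 f := by
  have hcont : Continuous (𝓕 f) := by
    have := VectorFourier.fourierIntegral_continuous (μ := (volume : Measure E)) (f := f)
      (e := Real.fourierChar) (L := innerₗ E) Real.continuous_fourierChar
      (by exact continuous_inner) h1
    exact this
  -- Both sides are locally integrable, so they can be compared against smooth compactly supported
  -- functions, onto which self-adjointness moves the transform.
  refine ae_eq_of_integral_contDiff_smul_eq
    ((Lp.memLp _).locallyIntegrable one_le_two) hcont.locallyIntegrable fun g hg hgc => ?_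
  have hs1 : HasCompactSupport (Complex.ofRealCLM ∘ g) := hgc.comp_left rfl
  let φ : 𝓢(E, ℂ) := hs1.toSchwartzMap (Complex.ofRealCLM.contDiff.comp hg)
  have hφ : ∀ x, φ x = (g x : ℂ) := fun x => rfl
  have key := congrArg (fun T : 𝓢'(E, ℂ) => T φ)
    (MeasureTheory.Lp.fourier_toTemperedDistribution_eq (h2.toLp f))
  simp only [TemperedDistribution.fourier_apply, Lp.toTemperedDistribution_apply] at key
  have e1 : ∫ x, g x • (𝓕 (h2.toLp f) : Lp ℂ 2 (volume : Measure E)) x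
      = ∫ x, φ x • (𝓕 (h2.toLp f) : Lp ℂ 2 (volume : Measure E)) x := by
    simp [hφ]
  have e2 : ∫ x, g x • (𝓕 f) x = ∫ x, (𝓕 f) x • φ x := by
    simp [hφ, mul_comm]
  rw [e1, ← key, e2]
  have e3 := VectorFourier.integral_fourierIntegral_smul_eq_flip (μ := (volume : Measure E))
    (ν := (volume : Measure E)) (f := f) (g := φ)
    (e := Real.fourierChar) (L := innerₗ E) Real.continuous_fourierChar
      (by exact continuous_inner) h1 φ.integrable
  rw [flip_innerₗ] at e3
  refine Eq.trans ?_ e3.symm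
  refine integral_congr_ae ?_
  filter_upwards [h2.coeFn_toLp] with x hx
  rw [hx, smul_eq_mul, smul_eq_mul, mul_comm]
  rfl

/-- Plancherel for `conj g` and `f`: at every point one of the two transforms vanishes.
Integrability is required besides square integrability so that the transforms are honest integrals
at each point. -/
theorem integral_mul_eq_zero_of_fourier_mul_eq_zero {f g : E → ℂ} (hf1 : Integrable f)
    (hf2 : MemLp f 2) (hg1 : Integrable g) (hg2 : MemLp g 2)
    (h : ∀ x : E, (∫ p, f p * exp (I * (inner ℝ x p : ℂ))) = 0 ∨
      (∫ p, g p * exp (-(I * (inner ℝ x p : ℂ)))) = 0) :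
    ∫ p, g p * f p = 0 := by
  have hs1 : Integrable fun p => conj (g p) := memLp_one_iff_integrable.1 (memLp_one_iff_integrable.2 hg1).star
  have hs2 : MemLp (fun p => conj (g p)) 2 := hg2.star
  have key := MeasureTheory.Lp.inner_fourier_eq (hs2.toLp _) (hf2.toLp f)
  have e1 : ∫ p, g p * f p = inner ℂ (hs2.toLp _) (hf2.toLp f) := by
    rw [L2.inner_def]
    refine integral_congr_ae ?_
    filter_upwards [hs2.coeFn_toLp, hf2.coeFn_toLp] with p h1 h2
    rw [h1, h2]
    simp [mul_comm]
  rw [e1, ← key, L2.inner_def]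
  refine integral_eq_zero_of_ae ?_
  filter_upwards [fourier_toLp_ae_eq hs1 hs2, fourier_toLp_ae_eq hf1 hf2] with w h1 h2
  rw [h1, h2]
  -- The frequency `w` in the `exp(-2πi⟪·,w⟫)` convention is the point `x = -2πw`.
  have e2 : 𝓕 f w = ∫ p, f p * exp (I * (inner ℝ (-(2 * Real.pi) • w) p : ℂ)) := by
    rw [Real.fourier_eq']
    refine integral_congr_ae (.of_forall fun p => ?_)
    simp only [smul_eq_mul]
    rw [mul_comm, inner_smul_left, real_inner_comm]
    congr 2
    simp
    ring
  have e3 : conj (𝓕 (fun p => conj (g p)) w)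
      = ∫ p, g p * exp (-(I * (inner ℝ (-(2 * Real.pi) • w) p : ℂ))) := by
    rw [Real.fourier_eq', ← integral_conj]
    refine integral_congr_ae (.of_forall fun p => ?_)
    simp only [smul_eq_mul, map_mul, conj_conj, ← exp_conj]
    rw [mul_comm, inner_smul_left, real_inner_comm]
    congr 2
    have h2 : conj (2 : ℂ) = 2 := map_ofNat _ 2
    simp [h2]
    ring
  simp only [Pi.zero_apply, RCLike.inner_apply]
  rcases h (-(2 * Real.pi) • w) with h | h
  · rw [e2, h, zero_mul]
  · rw [← e3] at h
    rw [h, mul_zero]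

end Plancherel

/-! ### Half-space supports -/

section HalfSpace

variable {d : ℕ}

theorem norm_exp_I_mul (r : ℝ) : ‖exp (I * (r : ℂ))‖ = 1 := by
  rw [mul_comm, norm_exp_ofReal_mul_I]

theorem norm_eps_add_I_mul {ε : ℝ} (r : ℝ) : ‖(ε : ℂ) + I * r‖ ^ 2 = ε ^ 2 + r ^ 2 := by
  rw [Complex.sq_norm, normSq_apply]
  simp
  ring

/-- The multiplier `i p₁ / (ε + i p₁)`. It is the Fourier transform of a measure supported in the
half-space `x₁ ≥ 0`, and regularizes infrared singularities. -/
def infraredCutoff [NeZero d] (ε : ℝ) (p : Space d) : ℂ :=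
  I * (p 0 : ℂ) / ((ε : ℂ) + I * (p 0 : ℂ))

theorem eps_add_I_mul_ne {ε : ℝ} (hε : 0 < ε) (r : ℝ) : (ε : ℂ) + I * r ≠ 0 := by
  intro h
  have := congrArg re h
  simp at this
  exact hε.ne' this

theorem norm_infraredCutoff_le_one [NeZero d] {ε : ℝ} (hε : 0 < ε) (p : Space d) :
    ‖infraredCutoff ε p‖ ≤ 1 := by
  rw [infraredCutoff, norm_div, div_le_one (norm_pos_iff.2 (eps_add_I_mul_ne hε _))]
  rw [← pow_le_pow_iff_left₀ (norm_nonneg _) (norm_nonneg _) two_ne_zero, norm_eps_add_I_mul]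
  simp
  positivity

theorem norm_infraredCutoff_le [NeZero d] {ε : ℝ} (hε : 0 < ε) (p : Space d) :
    ‖infraredCutoff ε p‖ ≤ ‖p‖ / ε := by
  have h1 : ε ≤ ‖(ε : ℂ) + I * (p 0 : ℂ)‖ := by
    rw [← pow_le_pow_iff_left₀ hε.le (norm_nonneg _) two_ne_zero, norm_eps_add_I_mul]
    nlinarith [sq_nonneg (p 0)]
  rw [infraredCutoff, norm_div]
  refine div_le_div₀ (norm_nonneg _) ?_ hε h1
  simpa using PiLp.norm_apply_le p 0

theorem continuous_infraredCutoff [NeZero d] {ε : ℝ} (hε : 0 < ε) :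
    Continuous (infraredCutoff ε : Space d → ℂ) := by
  unfold infraredCutoff
  exact Continuous.div (by fun_prop) (by fun_prop) fun p => eps_add_I_mul_ne hε _

/-- The cutoff equals `1 - ε ∫₀^∞ exp(-εs) exp(-isp₁) ds`, and each exponential only moves `x` to `x
- s e₁`, which stays in `x₁ ≤ 0`. -/
theorem integral_infraredCutoff_eq_zero [NeZero d] {f : Space d → ℂ} (hf : Integrable f)
    (h : ∀ x : Space d, x 0 ≤ 0 → ∫ p, f p * exp (I * (inner ℝ x p : ℂ)) = 0)
    {ε : ℝ} (hε : 0 < ε) (x : Space d) (hx : x 0 ≤ 0) :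
    ∫ p, infraredCutoff ε p * f p * exp (I * (inner ℝ x p : ℂ)) = 0 := by
  have hint : ∀ x : Space d, Integrable fun p => f p * exp (I * (inner ℝ x p : ℂ)) := by
    intro x
    refine hf.mul_bdd (c := 1) (Continuous.aestronglyMeasurable (by fun_prop))
      (.of_forall fun p => (norm_exp_I_mul _).le)
  let K : Space d → ℝ → ℂ := fun p s =>
    (f p * exp (I * (inner ℝ x p : ℂ))) * exp (-((ε : ℂ) + I * (p 0 : ℂ)) * s)
  have hexp : IntegrableOn (fun s : ℝ => Real.exp (-ε * s)) (Set.Ioi 0) :=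
    integrableOn_exp_mul_Ioi (by linarith) 0
  have hK : Integrable (Function.uncurry K) (volume.prod (volume.restrict (Set.Ioi 0))) := by
    have h1 := hf.norm.mul_prod hexp
    refine h1.mono' ?_ (.of_forall fun z => ?_)
    · have h2 : AEStronglyMeasurable (fun z : Space d × ℝ => f z.1)
          (volume.prod (volume.restrict (Set.Ioi 0))) :=
        hf.aestronglyMeasurable.comp_fst
      refine (h2.mul (Continuous.aestronglyMeasurable ?_)).mul
        (Continuous.aestronglyMeasurable ?_)
      · fun_prop
      · fun_prop
    · simp only [Function.uncurry, K, norm_mul, norm_exp_I_mul, mul_one]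
      rw [norm_exp]
      simp
  have hI : ∀ p : Space d, ∫ s in Set.Ioi (0 : ℝ), exp (-((ε : ℂ) + I * (p 0 : ℂ)) * s)
      = 1 / ((ε : ℂ) + I * (p 0 : ℂ)) := by
    intro p
    rw [integral_exp_mul_complex_Ioi (by simpa using hε)]
    simp only [ofReal_zero, mul_zero, exp_zero, neg_div_neg_eq]
  have e1 : ∀ p, infraredCutoff ε p * f p * exp (I * (inner ℝ x p : ℂ)) =
      f p * exp (I * (inner ℝ x p : ℂ)) - ε * ∫ s in Set.Ioi (0 : ℝ), K p s := by
    intro p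
    simp only [K]
    rw [integral_const_mul, hI, infraredCutoff]
    have := eps_add_I_mul_ne hε (p 0)
    field_simp
    ring
  have hK2 : Integrable fun p => ∫ s in Set.Ioi (0 : ℝ), K p s := hK.integral_prod_left
  simp_rw [e1]
  rw [integral_sub (hint x) (hK2.const_mul _), h x hx, integral_const_mul,
    integral_integral_swap hK]
  have e2 : ∀ s ∈ Set.Ioi (0 : ℝ), ∫ p, K p s = 0 := by
    intro s hs
    have h2 := h (x - s • EuclideanSpace.single 0 1) (by
      have : 0 < s := hs
      simp; linarith)
    have e3 : ∀ p, K p s = exp (-ε * s) *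
        (f p * exp (I * (inner ℝ (x - s • EuclideanSpace.single 0 1) p : ℂ))) := by
      intro p
      simp only [K]
      rw [inner_sub_left, inner_smul_left, EuclideanSpace.inner_single_left]
      rw [mul_left_comm, mul_assoc, ← exp_add, ← exp_add]
      congr 2
      simp
      ring
    simp_rw [e3]
    rw [integral_const_mul, h2, mul_zero]
  rw [setIntegral_congr_fun measurableSet_Ioi e2]
  simp

/-- A sequence of rapidly decreasing multipliers, bounded by `1` and tending to `1`. -/
structure IsMollifier (N : ℕ → Space d → ℂ) : Prop where
  continuous : ∀ n, Continuous (N n)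
  norm_le_one : ∀ n p, ‖N n p‖ ≤ 1
  decay : ∀ n, ∃ C, ∀ p, ‖N n p‖ ≤ C * (1 + ‖p‖) ^ (-((d : ℝ) + 2))
  tendsto : ∀ p, Tendsto (fun n => N n p) atTop (𝓝 1)

variable {m : ℝ} {N : ℕ → Space d → ℂ}

/-- With the weight in `L²`, the product `α · N/√ω` is integrable for every `α` in `L²`. Since `|N|²
≤ |N|`, the claim reduces to integrability of a decaying function against `dp/ω`. -/
theorem IsMollifier.memLp_div (hN : IsMollifier N) (hmd : 0 < m ∨ 2 ≤ d) (n : ℕ) :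
    MemLp (fun p => N n p / (√(energy m p) : ℂ)) 2 := by
  have hmeas : Measurable fun p => N n p / (√(energy m p) : ℂ) :=
    (hN.continuous n).measurable.div (by fun_prop)
  rw [memLp_two_iff_integrable_sq_norm hmeas.aestronglyMeasurable]
  obtain ⟨C, hC⟩ := hN.decay n
  refine ((integrable_decay_div_energy (m := m) hmd).const_mul C).mono'
    (hmeas.norm.pow_const 2).aestronglyMeasurable (.of_forall fun p => ?_)
  have hω := energy_nonneg m p
  have h1 := hN.norm_le_one n p
  have hle : (1 + ‖p‖) ^ (-((d : ℝ) + 2)) ≤ (1 + ‖p‖) ^ (-((d : ℝ) + 1)) :=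
    Real.rpow_le_rpow_of_exponent_le (by linarith [norm_nonneg p]) (by linarith)
  have hC0 : 0 ≤ C := by
    have h2 := (norm_nonneg _).trans (hC p)
    exact nonneg_of_mul_nonneg_left h2 (by positivity)
  rw [Real.norm_of_nonneg (by positivity), norm_div, div_pow, norm_real,
    Real.norm_of_nonneg (Real.sqrt_nonneg _), Real.sq_sqrt hω, ← mul_div_assoc]
  gcongr
  calc ‖N n p‖ ^ 2 ≤ ‖N n p‖ := by nlinarith [norm_nonneg (N n p)]
    _ ≤ _ := hC p
    _ ≤ _ := by gcongr

/-- One power of decay is spent on `ω ≤ (1 + |m|)(1 + ‖p‖)`. This is why `IsMollifier.decay` asks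
for exponent `d + 2` while `d + 1` is already integrable. -/
theorem IsMollifier.norm_mul_sq_le (hN : IsMollifier N) (m : ℝ) (n : ℕ) :
    ∃ C, ∀ p, ‖N n p * (√(energy m p) : ℂ)‖ ^ 2 ≤ C * (1 + ‖p‖) ^ (-((d : ℝ) + 1)) := by
  obtain ⟨C, hC⟩ := hN.decay n
  refine ⟨C * (1 + |m|), fun p => ?_⟩
  have hω := energy_nonneg m p
  have h1 := hN.norm_le_one n p
  rw [norm_mul, mul_pow, norm_real, Real.norm_of_nonneg (Real.sqrt_nonneg _), Real.sq_sqrt hω]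
  have e : (1 + ‖p‖) ^ (-((d : ℝ) + 1)) = (1 + ‖p‖) ^ (-((d : ℝ) + 2)) * (1 + ‖p‖) := by
    rw [← Real.rpow_add_one (by positivity)]
    congr 1; ring
  have h2 : energy m p ≤ (1 + |m|) * (1 + ‖p‖) := by
    have := energy_le m p
    nlinarith [mul_nonneg (norm_nonneg p) (abs_nonneg m)]
  calc ‖N n p‖ ^ 2 * energy m p ≤ ‖N n p‖ * ((1 + |m|) * (1 + ‖p‖)) := by
        gcongr
        nlinarith [norm_nonneg (N n p)]
    _ ≤ (C * (1 + ‖p‖) ^ (-((d : ℝ) + 2))) * ((1 + |m|) * (1 + ‖p‖)) := by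
        gcongr
        exact hC p
    _ = _ := by rw [e]; ring

theorem IsMollifier.memLp_mul (hN : IsMollifier N) (m : ℝ) (n : ℕ) :
    MemLp (fun p => N n p * (√(energy m p) : ℂ)) 2 := by
  have hmeas : Measurable fun p => N n p * (√(energy m p) : ℂ) :=
    (hN.continuous n).measurable.mul (by fun_prop)
  rw [memLp_two_iff_integrable_sq_norm hmeas.aestronglyMeasurable]
  obtain ⟨C, hC⟩ := hN.norm_mul_sq_le m n
  have hb : Integrable fun p : Space d => (1 + ‖p‖) ^ (-((d : ℝ) + 1)) :=
    integrable_one_add_norm (by simp)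
  refine (hb.const_mul C).mono' (hmeas.norm.pow_const 2).aestronglyMeasurable (.of_forall fun p => ?_)
  rw [Real.norm_of_nonneg (by positivity)]
  exact hC p

theorem IsMollifier.bounded_mul (hN : IsMollifier N) (m : ℝ) (n : ℕ) :
    ∃ C, ∀ p, ‖N n p * (√(energy m p) : ℂ)‖ ≤ C := by
  obtain ⟨C, hC⟩ := hN.norm_mul_sq_le m n
  refine ⟨√C, fun p => Real.le_sqrt_of_sq_le ((hC p).trans ?_)⟩
  have hC0 : 0 ≤ C := by
    have h2 := (sq_nonneg _).trans (hC p)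
    exact nonneg_of_mul_nonneg_left h2 (by positivity)
  refine mul_le_of_le_one_right hC0 ?_
  exact Real.rpow_le_one_of_one_le_of_nonpos (by linarith [norm_nonneg p]) (by linarith)

/-- Fourier transforms of distributions supported in opposite half-spaces are orthogonal. -/
theorem integral_mul_eq_zero_of_halfSpaces [NeZero d] (hmd : 0 < m ∨ 2 ≤ d)
    {M : ℕ → Space d → ℂ} (hN : IsMollifier N) (hM : IsMollifier M) {α β : Space d → ℂ}
    (hα : MemLp α 2) (hβ : MemLp β 2)
    (h1 : ∀ n, ∀ x : Space d, x 0 ≤ 0 →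
      ∫ p, α p * (N n p / (√(energy m p) : ℂ)) * exp (I * (inner ℝ x p : ℂ)) = 0)
    (h2 : ∀ n, ∀ x : Space d, 0 ≤ x 0 →
      ∫ p, β p * (M n p * (√(energy m p) : ℂ)) * exp (-(I * (inner ℝ x p : ℂ))) = 0) :
    ∫ p, β p * α p = 0 := by
  let ε : ℕ → ℝ := fun n => 1 / ((n : ℝ) + 1)
  have hε : ∀ n, 0 < ε n := fun n => by positivity
  have hεlim : Tendsto ε atTop (𝓝 0) := tendsto_one_div_add_atTop_nhds_zero_nat
  -- For fixed `n` both factors are integrable and square integrable with transforms vanishing on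
  -- complementary closed half-spaces. The cutoff is needed for square integrability of the factor
  -- containing `1/√ω`.
  have step : ∀ n, ∫ p, (β p * (M n p * (√(energy m p) : ℂ))) *
      (infraredCutoff (ε n) p * (α p * (N n p / (√(energy m p) : ℂ)))) = 0 := by
    intro n
    have hf1 : Integrable fun p => α p * (N n p / (√(energy m p) : ℂ)) :=
      hα.integrable_mul (hN.memLp_div hmd n)
    have hg1 : Integrable fun p => β p * (M n p * (√(energy m p) : ℂ)) :=
      hβ.integrable_mul (hM.memLp_mul m n)
    have hχ := continuous_infraredCutoff (d := d) (hε n)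
    obtain ⟨C, hC⟩ := hM.bounded_mul m n
    refine integral_mul_eq_zero_of_fourier_mul_eq_zero
      (hf1.bdd_mul (c := 1) hχ.aestronglyMeasurable
        (.of_forall fun p => norm_infraredCutoff_le_one (hε n) p)) ?_ hg1 ?_ fun x => ?_
    · refine hα.of_le_mul (c := √(1 / ε n)) (hχ.aestronglyMeasurable.mul hf1.aestronglyMeasurable)
        (.of_forall fun p => ?_)
      have hω := energy_nonneg m p
      -- The bound comes from `|χ|² ≤ |χ| ≤ ‖p‖/ε ≤ ω/ε` for the cutoff `χ`: it exactly compensates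
      -- the `1/ω` in the squared weight.
      have h3 : ‖infraredCutoff (ε n) p‖ * ‖N n p / (√(energy m p) : ℂ)‖ ≤ √(1 / ε n) := by
        refine Real.le_sqrt_of_sq_le ?_
        rw [norm_div, norm_real, Real.norm_of_nonneg (Real.sqrt_nonneg _), mul_pow, div_pow,
          Real.sq_sqrt hω]
        have h4 := norm_infraredCutoff_le_one (hε n) p
        have h5 := norm_infraredCutoff_le (hε n) p
        have h6 := norm_le_energy m p
        have h7 : ‖infraredCutoff (ε n) p‖ ^ 2 ≤ energy m p / ε n := by
          calc ‖infraredCutoff (ε n) p‖ ^ 2 ≤ ‖infraredCutoff (ε n) p‖ := by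
                nlinarith [norm_nonneg (infraredCutoff (ε n) p)]
            _ ≤ ‖p‖ / ε n := h5
            _ ≤ _ := by have := hε n; gcongr
        have h8 : ‖N n p‖ ^ 2 ≤ 1 := pow_le_one₀ (norm_nonneg _) (hN.norm_le_one n p)
        have := hε n
        rcases hω.eq_or_lt with h9 | h9
        · rw [← h9]; simp; positivity
        · calc ‖infraredCutoff (ε n) p‖ ^ 2 * (‖N n p‖ ^ 2 / energy m p)
              ≤ (energy m p / ε n) * (1 / energy m p) := by gcongr
            _ = 1 / ε n := by field_simp
      calc ‖infraredCutoff (ε n) p * (α p * (N n p / (√(energy m p) : ℂ)))‖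
          = (‖infraredCutoff (ε n) p‖ * ‖N n p / (√(energy m p) : ℂ)‖) * ‖α p‖ := by
            rw [norm_mul, norm_mul]; ring
        _ ≤ _ := by gcongr
    · refine hβ.of_le_mul (c := C) hg1.aestronglyMeasurable (.of_forall fun p => ?_)
      rw [norm_mul, mul_comm]
      gcongr
      exact hC p
    · rcases le_total (x 0) 0 with hx | hx
      · left
        exact integral_infraredCutoff_eq_zero hf1 (h1 n) (hε n) x hx
      · right
        exact h2 n x hx
  have hαβ : Integrable fun p => β p * α p := hβ.integrable_mul hα
  -- The cutoff tends to `1` only off the hyperplane `p₁ = 0`, where it vanishes identically.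
  have hae : ∀ᵐ p : Space d, p 0 ≠ 0 := by
    have h0 : (LinearMap.ker (EuclideanSpace.proj (𝕜 := ℝ) (0 : Fin d)).toLinearMap) ≠ ⊤ := by
      intro h
      have : (EuclideanSpace.single (0 : Fin d) (1 : ℝ)) ∈
        LinearMap.ker (EuclideanSpace.proj (𝕜 := ℝ) (0 : Fin d)).toLinearMap := h ▸ trivial
      simp at this
    have := Measure.addHaar_submodule (volume : Measure (Space d)) _ h0
    filter_upwards [compl_mem_ae_iff.2 this] with p hp
    simpa using hp
  have hlim : Tendsto (fun n => ∫ p, (β p * (M n p * (√(energy m p) : ℂ))) *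
      (infraredCutoff (ε n) p * (α p * (N n p / (√(energy m p) : ℂ))))) atTop
      (𝓝 (∫ p, β p * α p)) := by
    refine tendsto_integral_of_dominated_convergence (fun p => ‖β p * α p‖) (fun n => ?_)
      hαβ.norm (fun n => .of_forall fun p => ?_) ?_
    · exact (hβ.1.mul (hM.memLp_mul m n).1).mul
        ((continuous_infraredCutoff (hε n)).aestronglyMeasurable.mul
          (hα.1.mul (hN.memLp_div hmd n).1))
    -- The energy may vanish at the origin, where the quotient is `0`; an inequality avoids the case
    -- distinction.
    · have hω : ‖(√(energy m p) : ℂ)‖ / ‖(√(energy m p) : ℂ)‖ ≤ 1 := div_self_le_one _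
      have h3 := hN.norm_le_one n p
      have h4 := hM.norm_le_one n p
      have h5 := norm_infraredCutoff_le_one (hε n) p
      calc _ = ‖β p * α p‖ * (‖M n p‖ * ‖infraredCutoff (ε n) p‖ * ‖N n p‖ *
            (‖(√(energy m p) : ℂ)‖ / ‖(√(energy m p) : ℂ)‖)) := by
            simp only [norm_mul, norm_div]; ring
        _ ≤ ‖β p * α p‖ * (1 * 1 * 1 * 1) := by gcongr
        _ = _ := by ring
    · filter_upwards [hae, ae_energy_pos m] with p hp hω
      have hω' : (√(energy m p) : ℂ) ≠ 0 := by
        exact_mod_cast (Real.sqrt_pos.2 hω).ne'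
      have hp' : I * (p 0 : ℂ) ≠ 0 := mul_ne_zero I_ne_zero (by exact_mod_cast hp)
      have h3 : Tendsto (fun n => infraredCutoff (ε n) p) atTop (𝓝 1) := by
        have h4 : Tendsto (fun n => ((ε n : ℝ) : ℂ)) atTop (𝓝 ((0 : ℝ) : ℂ)) :=
          (continuous_ofReal.tendsto 0).comp hεlim
        have h5 : Tendsto (fun n => infraredCutoff (ε n) p) atTop
            (𝓝 (I * (p 0 : ℂ) / (((0 : ℝ) : ℂ) + I * (p 0 : ℂ)))) :=
          (tendsto_const_nhds (x := I * (p 0 : ℂ))).div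
          (h4.add (tendsto_const_nhds (x := I * (p 0 : ℂ)))) (by simpa using hp')
        rwa [ofReal_zero, zero_add, div_self hp'] at h5
      have h6 := (((hM.tendsto p).mul h3).mul (hN.tendsto p)).const_mul (β p * α p)
      simp only [mul_one] at h6
      refine h6.congr fun n => ?_
      field_simp
  simp_rw [step] at hlim
  exact tendsto_nhds_unique hlim tendsto_const_nhds |>.symm ▸ rfl

end HalfSpace

/-! ### The Fourier transform on space -/

section SpaceFourier

variable {d : ℕ}

/-- The Fourier transform `∫ g(x) e^{ix·p} dx` of a real function on space. -/
def spaceFourier (g : Space d → ℝ) (p : Space d) : ℂ :=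
  ∫ x : Space d, (g x : ℂ) * exp (I * (inner ℝ x p : ℂ))

theorem spaceFourier_neg (g : Space d → ℝ) (p : Space d) :
    spaceFourier g (-p) = conj (spaceFourier g p) := by
  rw [spaceFourier, spaceFourier, ← integral_conj]
  refine integral_congr_ae (.of_forall fun x => ?_)
  simp [← exp_conj]

/-- This is how the plane waves in the half-space conditions arise: they are translations of a fixed
test function. -/
theorem spaceFourier_comp_sub (g : Space d → ℝ) (x p : Space d) :
    spaceFourier (fun y => g (y - x)) p = spaceFourier g p * exp (I * (inner ℝ x p : ℂ)) := by
  rw [spaceFourier, spaceFourier, ← integral_mul_const, ← integral_add_right_eq_self _ x]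
  refine integral_congr_ae (.of_forall fun y => ?_)
  simp only [add_sub_cancel_right]
  rw [mul_assoc, ← exp_add, inner_add_left]
  congr 2
  push_cast
  ring

theorem exists_schwartz_spaceFourier (g : 𝓢(Space d, ℝ)) :
    ∃ F : 𝓢(Space d, ℂ), ∀ p, F p = spaceFourier g p := by
  let gc : 𝓢(Space d, ℂ) := SchwartzMap.postcompCLM Complex.ofRealCLM g
  have hgc : ∀ x, gc x = (g x : ℂ) := fun x => rfl
  let e : Space d ≃L[ℝ] Space d := ContinuousLinearEquiv.smulLeft
    (Units.mk0 (-(2 * Real.pi)⁻¹) (neg_ne_zero.mpr (by positivity)))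
  have he : ∀ x, e x = (-(2 * Real.pi)⁻¹) • x := fun x => rfl
  refine ⟨SchwartzMap.compCLMOfContinuousLinearEquiv ℂ e (𝓕 gc), fun p => ?_⟩
  have h1 : SchwartzMap.compCLMOfContinuousLinearEquiv ℂ e (𝓕 gc) p
      = 𝓕 (gc : Space d → ℂ) (e p) := rfl
  rw [h1, Real.fourier_eq', spaceFourier]
  refine integral_congr_ae (.of_forall fun x => ?_)
  simp only [smul_eq_mul, hgc, he, inner_smul_right]
  rw [mul_comm]
  congr 2
  have := Real.pi_ne_zero
  push_cast
  have h2 : (Real.pi : ℂ) ≠ 0 := by exact_mod_cast this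
  field_simp

theorem _root_.SchwartzMap.exists_norm_le_one_add_norm_rpow (F : 𝓢(Space d, ℂ)) :
    ∃ C, ∀ p, ‖F p‖ ≤ C * (1 + ‖p‖) ^ (-((d : ℝ) + 2)) := by
  have h := SchwartzMap.one_add_le_sup_seminorm_apply (𝕜 := ℝ) (m := (d + 2, 0))
    (k := d + 2) (n := 0) le_rfl le_rfl F
  refine ⟨2 ^ (d + 2) * ((Finset.Iic (d + 2, 0)).sup
      fun m => SchwartzMap.seminorm ℝ m.1 m.2) F, fun p => ?_⟩
  have h1 := h p
  rw [norm_iteratedFDeriv_zero] at h1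
  have e : (1 + ‖p‖) ^ (-((d : ℝ) + 2)) = ((1 + ‖p‖) ^ (d + 2))⁻¹ := by
    rw [Real.rpow_neg (by positivity), ← Real.rpow_natCast]
    push_cast; rfl
  rw [e, ← div_eq_mul_inv, le_div_iff₀ (by positivity), mul_comm]
  exact h1

theorem norm_spaceFourier_le {g : Space d → ℝ} (h0 : ∀ x, 0 ≤ g x) (p : Space d) :
    ‖spaceFourier g p‖ ≤ ∫ x, g x := by
  refine (norm_integral_le_integral_norm _).trans (le_of_eq ?_)
  refine integral_congr_ae (.of_forall fun x => ?_)
  simp [abs_of_nonneg (h0 x)]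

end SpaceFourier

/-! ### Bump functions -/

section Bump

variable {E : Type*} [NormedAddCommGroup E] [InnerProductSpace ℝ E] [FiniteDimensional ℝ E]
  [MeasurableSpace E] [BorelSpace E]

/-- A smooth probability density supported in the ball of radius `r` about `c`. -/
structure IsBump (c : E) (r : ℝ) (φ : E → ℝ) : Prop where
  contDiff : ContDiff ℝ ∞ φ
  hasCompactSupport : HasCompactSupport φ
  tsupport_subset : tsupport φ ⊆ Metric.closedBall c r
  nonneg : ∀ x, 0 ≤ φ x
  integral_eq_one : ∫ x, φ x = 1
  symm : ∀ x, φ (c - x) = φ (c + x)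

theorem exists_isBump (c : E) {r : ℝ} (hr : 0 < r) : ∃ φ, IsBump c r φ := by
  let f : ContDiffBump c := ⟨r / 2, r, by positivity, by linarith⟩
  exact ⟨f.normed volume, f.contDiff_normed, f.hasCompactSupport_normed,
    (f.tsupport_normed_eq (μ := volume)).le, f.nonneg_normed, f.integral_normed,
    f.normed_sub⟩

theorem IsBump.integrable {c : E} {r : ℝ} {φ : E → ℝ} (h : IsBump c r φ) : Integrable φ :=
  h.contDiff.continuous.integrable_of_hasCompactSupport h.hasCompactSupport

/-- On the support `|exp(iθ) - 1| ≤ |θ| ≤ L(‖c‖ + r)`, and `φ` has mass one. Applied in space and in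
time, this makes the multipliers tend to `1`. -/
theorem IsBump.norm_integral_exp_sub_one_le {c : E} {r : ℝ} {φ : E → ℝ} (h : IsBump c r φ)
    {θ : E → ℝ} (hθ : Continuous θ) {L : ℝ} (hL : 0 ≤ L) (hle : ∀ x, |θ x| ≤ L * ‖x‖) :
    ‖(∫ x, (φ x : ℂ) * exp (I * θ x)) - 1‖ ≤ L * (‖c‖ + r) := by
  have h1 : Integrable fun x => (φ x : ℂ) * exp (I * θ x) :=
    h.integrable.ofReal.mul_bdd (c := 1) (Continuous.aestronglyMeasurable (by fun_prop))
      (.of_forall fun p => (norm_exp_I_mul _).le)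
  have h3 : Integrable fun x => (φ x : ℂ) := h.integrable.ofReal
  have h2 : (∫ x, (φ x : ℂ)) = 1 := by
    rw [integral_complex_ofReal, h.integral_eq_one, ofReal_one]
  rw [← h2, ← integral_sub h1 h3]
  calc _ ≤ ∫ x, φ x * (L * (‖c‖ + r)) := by
        refine norm_integral_le_of_norm_le (h.integrable.mul_const _) (.of_forall fun x => ?_)
        have e : (φ x : ℂ) * exp (I * θ x) - φ x = φ x * (exp (I * θ x) - 1) := by ring
        rw [e, norm_mul, norm_real, Real.norm_of_nonneg (h.nonneg x)]
        by_cases hx : x ∈ tsupport φ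
        · have h3 := h.tsupport_subset hx
          rw [Metric.mem_closedBall, dist_eq_norm] at h3
          have h4 : ‖x‖ ≤ ‖c‖ + r := by
            calc ‖x‖ = ‖c + (x - c)‖ := by congr 1; abel
              _ ≤ ‖c‖ + ‖x - c‖ := norm_add_le _ _
              _ ≤ _ := by gcongr
          refine mul_le_mul_of_nonneg_left ?_ (h.nonneg x)
          calc _ ≤ ‖θ x‖ := Real.norm_exp_I_mul_ofReal_sub_one_le
            _ ≤ L * ‖x‖ := hle x
            _ ≤ _ := by gcongr
        · simp [image_eq_zero_of_notMem_tsupport hx]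
    _ = _ := by rw [integral_mul_const, h.integral_eq_one, one_mul]

variable {d : ℕ}

theorem IsBump.exists_schwartz {c : E} {r : ℝ} {φ : E → ℝ} (h : IsBump c r φ) :
    ∃ g : 𝓢(E, ℝ), (g : E → ℝ) = φ :=
  ⟨h.hasCompactSupport.toSchwartzMap h.contDiff, rfl⟩

/-- The centres `c n` may differ from zero: shrinking bumps are used that sit strictly on one side
of `x₁ = 0`. -/
theorem isMollifier_spaceFourier {c : ℕ → Space d} {r : ℕ → ℝ} {φ : ℕ → Space d → ℝ}
    (h : ∀ n, IsBump (c n) (r n) (φ n)) (hc : Tendsto (fun n => ‖c n‖ + r n) atTop (𝓝 0)) :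
    IsMollifier fun n => spaceFourier (φ n) := by
  have hS : ∀ n, ∃ F : 𝓢(Space d, ℂ), ∀ p, F p = spaceFourier (φ n) p := by
    intro n
    obtain ⟨g, hg⟩ := (h n).exists_schwartz
    rw [← hg]
    exact exists_schwartz_spaceFourier g
  refine ⟨fun n => ?_, fun n p => ?_, fun n => ?_, fun p => ?_⟩
  · obtain ⟨F, hF⟩ := hS n
    rw [show spaceFourier (φ n) = F from funext fun p => (hF p).symm]
    exact F.continuous
  · exact (norm_spaceFourier_le (h n).nonneg p).trans (h n).integral_eq_one.le
  · obtain ⟨F, hF⟩ := hS n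
    simp_rw [← hF]
    exact F.exists_norm_le_one_add_norm_rpow
  · rw [tendsto_iff_norm_sub_tendsto_zero]
    refine squeeze_zero (fun _ => norm_nonneg _) (fun n => ?_)
      (by simpa using hc.const_mul ‖p‖)
    exact (h n).norm_integral_exp_sub_one_le (θ := fun x => inner ℝ x p) (by fun_prop)
      (norm_nonneg p) fun x => by
        rw [mul_comm]; exact abs_real_inner_le_norm x p

/-- The Fourier transform of a function of time. -/
def timeFourier (η : ℝ → ℝ) (s : ℝ) : ℂ := ∫ t : ℝ, (η t : ℂ) * exp (I * ((s * t : ℝ) : ℂ))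

/-- Symmetry of the bump about zero makes its transform real, so multiplying by it at `ω(p)`
preserves invariance under `reflect`. -/
theorem conj_timeFourier {r : ℝ} {η : ℝ → ℝ} (h : IsBump 0 r η) (s : ℝ) :
    conj (timeFourier η s) = timeFourier η s := by
  rw [timeFourier, ← integral_conj, ← integral_neg_eq_self]
  refine integral_congr_ae (.of_forall fun t => ?_)
  have := h.symm t
  rw [zero_sub, zero_add] at this
  simp [← exp_conj, this]

theorem IsMollifier.timeFourier_mul {m : ℝ} {N : ℕ → Space d → ℂ} (hN : IsMollifier N)
    {r : ℕ → ℝ} {η : ℕ → ℝ → ℝ} (h : ∀ n, IsBump 0 (r n) (η n)) (hr : Tendsto r atTop (𝓝 0)) :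
    IsMollifier fun n p => timeFourier (η n) (energy m p) * N n p := by
  have hle : ∀ n s, ‖timeFourier (η n) s‖ ≤ 1 := by
    intro n s
    refine (norm_integral_le_integral_norm _).trans (le_of_eq ?_)
    rw [← (h n).integral_eq_one]
    refine integral_congr_ae (.of_forall fun x => ?_)
    simp only [norm_mul, norm_exp_I_mul]
    simp [abs_of_nonneg ((h n).nonneg x)]
  refine ⟨fun n => ?_, fun n p => ?_, fun n => ?_, fun p => ?_⟩
  · refine Continuous.mul ?_ (hN.continuous n)
    have : Continuous (timeFourier (η n)) := by
      refine continuous_of_dominated (F := fun (s : ℝ) (t : ℝ) =>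
        (η n t : ℂ) * exp (I * ((s * t : ℝ) : ℂ))) (bound := fun t => ‖η n t‖) (fun s => ?_)
        (fun s => .of_forall fun t => ?_) (h n).integrable.norm (.of_forall fun t => ?_)
      · have := (h n).contDiff.continuous
        exact Continuous.aestronglyMeasurable (by fun_prop)
      · rw [norm_mul, norm_exp_I_mul, mul_one, norm_real]
      · fun_prop
    exact this.comp (continuous_energy m)
  · rw [norm_mul]
    exact mul_le_one₀ (hle _ _) (norm_nonneg _) (hN.norm_le_one n p)
  · obtain ⟨C, hC⟩ := hN.decay n
    refine ⟨C, fun p => ?_⟩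
    rw [norm_mul]
    exact (mul_le_of_le_one_left (norm_nonneg _) (hle _ _)).trans (hC p)
  · have h1 : Tendsto (fun n => timeFourier (η n) (energy m p)) atTop (𝓝 1) := by
      rw [tendsto_iff_norm_sub_tendsto_zero]
      refine squeeze_zero (fun _ => norm_nonneg _) (fun n => ?_)
        (by simpa using hr.const_mul (energy m p))
      have := (h n).norm_integral_exp_sub_one_le (θ := fun t => energy m p * t) (by fun_prop)
        (energy_nonneg m p) fun x => by
          rw [abs_mul, abs_of_nonneg (energy_nonneg m p), Real.norm_eq_abs]
      simpa [timeFourier] using this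
    simpa using h1.mul (hN.tendsto p)

end Bump

/-! ### Hermitian and anti-Hermitian parts -/

section Duality

variable {d : ℕ} {m : ℝ}

/-- The reflection `c ↦ conj c(-p)`. -/
def reflect (c : Space d → ℂ) (p : Space d) : ℂ := conj (c (-p))

theorem integral_reflect_mul {c F : Space d → ℂ} (hF : reflect F = F) :
    ∫ p, reflect c p * F p = conj (∫ p, c p * F p) := by
  rw [← integral_conj, ← integral_neg_eq_self]
  refine integral_congr_ae (.of_forall fun p => ?_)
  have := congrFun hF (-p)
  simp only [reflect, neg_neg] at this
  simp [reflect, ← this]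

theorem memLp_reflect {c : Space d → ℂ} (hc : MemLp c 2) : MemLp (reflect c) 2 :=
  (hc.comp_measurePreserving (Measure.measurePreserving_neg volume)).star

theorem _root_.MeasureTheory.MemLp.integrable_fun_mul {f g : Space d → ℂ} (hf : MemLp f 2)
    (hg : MemLp g 2) : Integrable fun p => f p * g p :=
  hf.integrable_mul hg

/-- The Hermitian part. -/
def hermitianPart (c : Space d → ℂ) (p : Space d) : ℂ := (c p + reflect c p) / 2

/-- The anti-Hermitian part. -/
def skewPart (c : Space d → ℂ) (p : Space d) : ℂ := (c p - reflect c p) / 2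

theorem memLp_hermitianPart {c : Space d → ℂ} (hc : MemLp c 2) : MemLp (hermitianPart c) 2 := by
  exact (hc.add (memLp_reflect hc)).mul_const ((2 : ℂ)⁻¹)

theorem memLp_skewPart {c : Space d → ℂ} (hc : MemLp c 2) : MemLp (skewPart c) 2 := by
  exact (hc.sub (memLp_reflect hc)).mul_const ((2 : ℂ)⁻¹)

/-- Transforms of real functions are invariant under `reflect`. Against them, taking the real part
of the integral amounts to symmetrizing `c`, which turns conditions on real parts into linear
conditions on one function. -/
theorem integral_hermitianPart_mul {c F : Space d → ℂ} (hc : MemLp c 2) (hF2 : MemLp F 2)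
    (hF : reflect F = F) : ∫ p, hermitianPart c p * F p = ((∫ p, c p * F p).re : ℂ) := by
  have e : ∀ p, hermitianPart c p * F p = (c p * F p + reflect c p * F p) / 2 := by
    intro p; rw [hermitianPart]; ring
  simp_rw [e]
  rw [integral_div, integral_add (hc.integrable_fun_mul hF2) ((memLp_reflect hc).integrable_fun_mul hF2),
    integral_reflect_mul hF, add_conj]
  push_cast
  ring

theorem integral_skewPart_mul {c F : Space d → ℂ} (hc : MemLp c 2) (hF2 : MemLp F 2)
    (hF : reflect F = F) : ∫ p, skewPart c p * F p = ((∫ p, c p * F p).im : ℂ) * I := by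
  have e : ∀ p, skewPart c p * F p = (c p * F p - reflect c p * F p) / 2 := by
    intro p; rw [skewPart]; ring
  simp_rw [e]
  rw [integral_div, integral_sub (hc.integrable_fun_mul hF2) ((memLp_reflect hc).integrable_fun_mul hF2),
    integral_reflect_mul hF, sub_conj]
  push_cast
  ring

/-- The mixed products of Hermitian and anti-Hermitian parts cancel, and what remains is the average
of `uc` and its reflection, whose integrals are conjugate. -/
theorem re_integral_mul_eq {c u : Space d → ℂ} (hc : MemLp c 2) (hu : MemLp u 2) :
    ((∫ p, u p * c p).re : ℂ) = (∫ p, hermitianPart u p * hermitianPart c p) +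
      ∫ p, skewPart c p * skewPart u p := by
  rw [← integral_add ((memLp_hermitianPart hu).integrable_fun_mul (memLp_hermitianPart hc))
    ((memLp_skewPart hc).integrable_fun_mul (memLp_skewPart hu))]
  have e : ∀ p, hermitianPart u p * hermitianPart c p + skewPart c p * skewPart u p
      = (u p * c p + reflect u p * reflect c p) / 2 := by
    intro p; rw [hermitianPart, hermitianPart, skewPart, skewPart]; ring
  have e2 : ∫ p, reflect u p * reflect c p = conj (∫ p, u p * c p) := by
    rw [← integral_conj, ← integral_neg_eq_self]
    refine integral_congr_ae (.of_forall fun p => ?_)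
    simp [reflect]
  simp_rw [e]
  rw [integral_div, integral_add (hu.integrable_fun_mul hc)
    ((memLp_reflect hu).integrable_fun_mul (memLp_reflect hc)), e2, add_conj]
  push_cast
  ring

/-- Time zero fields localized in opposite half-spaces are symplectically orthogonal. -/
theorem re_integral_mul_eq_zero_of_halfSpaces [NeZero d] (hmd : 0 < m ∨ 2 ≤ d)
    {N M : ℕ → Space d → ℂ} (hN : IsMollifier N) (hM : IsMollifier M)
    (hN' : ∀ n, reflect (N n) = N n) (hM' : ∀ n, reflect (M n) = M n) {c u : Space d → ℂ}
    (hc : MemLp c 2) (hu : MemLp u 2)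
    (hc1 : ∀ n, ∀ x : Space d, x 0 ≤ 0 →
      (∫ p, c p * (N n p / (√(energy m p) : ℂ) * exp (I * (inner ℝ x p : ℂ)))).re = 0)
    (hc2 : ∀ n, ∀ x : Space d, x 0 ≤ 0 →
      (∫ p, c p * (N n p * (√(energy m p) : ℂ) * exp (I * (inner ℝ x p : ℂ)))).im = 0)
    (hu1 : ∀ n, ∀ x : Space d, 0 ≤ x 0 →
      (∫ p, u p * (M n p / (√(energy m p) : ℂ) * exp (-(I * (inner ℝ x p : ℂ))))).im = 0)
    (hu2 : ∀ n, ∀ x : Space d, 0 ≤ x 0 →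
      (∫ p, u p * (M n p * (√(energy m p) : ℂ) * exp (-(I * (inner ℝ x p : ℂ))))).re = 0) :
    (∫ p, u p * c p).re = 0 := by
  have hmul : ∀ {K : ℕ → Space d → ℂ}, IsMollifier K → ∀ n (x : Space d), MemLp
      (fun p => K n p * (√(energy m p) : ℂ) * exp (I * (inner ℝ x p : ℂ))) 2 := fun hK n x =>
    (hK.memLp_mul m n).of_le ((hK.memLp_mul m n).1.mul
      (Continuous.aestronglyMeasurable (by fun_prop)))
      (.of_forall fun p => by rw [norm_mul, norm_exp_I_mul, mul_one])
  have hdiv : ∀ {K : ℕ → Space d → ℂ}, IsMollifier K → ∀ n (x : Space d), MemLp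
      (fun p => K n p / (√(energy m p) : ℂ) * exp (I * (inner ℝ x p : ℂ))) 2 := fun hK n x =>
    (hK.memLp_div hmd n).of_le ((hK.memLp_div hmd n).1.mul
      (Continuous.aestronglyMeasurable (by fun_prop)))
      (.of_forall fun p => by rw [norm_mul, norm_exp_I_mul, mul_one])
  have rmul : ∀ {K : Space d → ℂ}, reflect K = K → ∀ x : Space d, reflect
      (fun p => K p * (√(energy m p) : ℂ) * exp (I * (inner ℝ x p : ℂ))) =
      (fun p => K p * (√(energy m p) : ℂ) * exp (I * (inner ℝ x p : ℂ))) := by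
    intro K hK x
    funext p
    have := congrFun hK p
    simp only [reflect] at this
    simp [reflect, this, ← exp_conj]
  have rdiv : ∀ {K : Space d → ℂ}, reflect K = K → ∀ x : Space d, reflect
      (fun p => K p / (√(energy m p) : ℂ) * exp (I * (inner ℝ x p : ℂ))) =
      (fun p => K p / (√(energy m p) : ℂ) * exp (I * (inner ℝ x p : ℂ))) := by
    intro K hK x
    funext p
    have := congrFun hK p
    simp only [reflect] at this
    simp [reflect, this, ← exp_conj]
  have hneg : ∀ x p : Space d, exp (-(I * (inner ℝ x p : ℂ))) = exp (I * (inner ℝ (-x) p : ℂ)) := by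
    intro x p; simp
  have k1 := integral_mul_eq_zero_of_halfSpaces hmd hN hM (memLp_hermitianPart hc)
    (memLp_hermitianPart hu) (fun n x hx => by
      simp_rw [mul_assoc (hermitianPart c _)]
      rw [integral_hermitianPart_mul hc (hdiv hN n x) (rdiv (hN' n) x), hc1 n x hx, ofReal_zero])
    (fun n x hx => by
      have := hu2 n x hx
      simp_rw [mul_assoc (hermitianPart u _), hneg] at this ⊢
      rw [integral_hermitianPart_mul hu (hmul hM n _) (rmul (hM' n) _), this, ofReal_zero])
  -- For the anti-Hermitian parts the weights are exchanged: `u` carries `1/√ω` and `c` carries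
  -- `√ω`. The roles are swapped accordingly, and `x ↦ -x` restores the sign of the exponents.
  have k2 := integral_mul_eq_zero_of_halfSpaces hmd hM hN (memLp_skewPart hu)
    (memLp_skewPart hc) (fun n x hx => by
      have := hu1 n (-x) (by simpa using hx)
      simp_rw [mul_assoc (skewPart u _), hneg, neg_neg] at this ⊢
      rw [integral_skewPart_mul hu (hdiv hM n x) (rdiv (hM' n) x), this, ofReal_zero, zero_mul])
    (fun n x hx => by
      have := hc2 n (-x) (by simpa using hx)
      simp_rw [mul_assoc (skewPart c _), hneg] at this ⊢
      rw [integral_skewPart_mul hc (hmul hN n _) (rmul (hN' n) _), this, ofReal_zero, zero_mul])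
  have := re_integral_mul_eq hc hu
  rw [k1, k2, add_zero] at this
  exact_mod_cast this

end Duality

/-! ### Test functions on spacetime -/

section Spacetime

variable {d : ℕ} {m : ℝ}

theorem lorentz_eq (k x : Spacetime d) :
    lorentz k x = k 0 * x 0 - inner ℝ (spatial d x) (spatial d k) := by
  simp [lorentz, PiLp.inner_apply]

theorem lorentz_event (s t : ℝ) (p y : Space d) :
    lorentz (event s p) (event t y) = s * t - inner ℝ y p := by
  simp [lorentz_eq]

/-- The Fourier transform of a product of a function of time and a translated function on space. -/
theorem lorentzFourier_mul (η : ℝ → ℝ) (j : Space d → ℝ) (x : Space d) (s : ℝ) (p : Space d) :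
    lorentzFourier (fun k : Spacetime d => ((η (k 0) * j (spatial d k - x) : ℝ) : ℂ)) (event s p) =
      fourierConst d * (timeFourier η s * spaceFourier j (-p) * exp (-(I * (inner ℝ x p : ℂ)))) := by
  rw [lorentzFourier, integral_event]
  congr 1
  have h := spaceFourier_comp_sub j x (-p)
  have e : spaceFourier j (-p) * exp (-(I * (inner ℝ x p : ℂ))) =
      spaceFourier (fun y => j (y - x)) (-p) := by
    rw [h]; simp
  rw [mul_assoc, e, timeFourier, spaceFourier, ← integral_prod_mul]
  refine integral_congr_ae (.of_forall fun z => ?_)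
  simp only [event_zero, spatial_event, lorentz_event, inner_neg_right]
  push_cast
  rw [mul_mul_mul_comm, ← exp_add]
  congr 2
  ring

/-- The derivative of a function on spacetime with respect to time. -/
def timeDeriv (f : Spacetime d → ℝ) (x : Spacetime d) : ℝ := fderiv ℝ f x (event 1 0)

theorem contDiff_timeDeriv {f : Spacetime d → ℝ} (hf : ContDiff ℝ ∞ f) :
    ContDiff ℝ ∞ (timeDeriv f) :=
  (hf.fderiv_right (m := ∞) (by simp)).clm_apply contDiff_const

theorem tsupport_timeDeriv_subset (f : Spacetime d → ℝ) : tsupport (timeDeriv f) ⊆ tsupport f :=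
  tsupport_fderiv_apply_subset ℝ _

theorem hasCompactSupport_timeDeriv {f : Spacetime d → ℝ} (hf : HasCompactSupport f) :
    HasCompactSupport (timeDeriv f) :=
  hf.mono' ((subset_tsupport _).trans (tsupport_timeDeriv_subset f))

/-- Integration by parts, stated for any eigenfunction `e` of the time derivative so as to cover
both real momenta and complex rapidities. -/
theorem integral_timeDeriv_mul {f : Spacetime d → ℝ} (hf : ContDiff ℝ ∞ f)
    (hfc : HasCompactSupport f) {e : Spacetime d → ℂ} (he : ContDiff ℝ 1 e) {a : ℂ}
    (hea : ∀ x, fderiv ℝ e x (event 1 0) = a * e x) :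
    ∫ x, (timeDeriv f x : ℂ) * e x = -a * ∫ x, (f x : ℂ) * e x := by
  have hfd : ∀ x, fderiv ℝ (fun x => (f x : ℂ)) x (event 1 0) = (timeDeriv f x : ℂ) := by
    intro x
    have h := (hf.differentiable (by simp) x).hasFDerivAt
    have h2 := (Complex.ofRealCLM.hasFDerivAt (x := f x)).comp x h
    have h3 : HasFDerivAt (fun x => (f x : ℂ)) (Complex.ofRealCLM.comp (fderiv ℝ f x)) x := h2
    rw [h3.fderiv]
    rfl
  have hcs : HasCompactSupport fun x => (f x : ℂ) := hfc.comp_left (g := ((↑) : ℝ → ℂ)) rfl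
  have hcs' : HasCompactSupport fun x => (timeDeriv f x : ℂ) :=
    (hasCompactSupport_timeDeriv hfc).comp_left (g := ((↑) : ℝ → ℂ)) rfl
  have hfcont := hf.continuous
  have hgcont := (contDiff_timeDeriv hf).continuous
  have hecont := he.continuous
  have i1 : Integrable fun x => (f x : ℂ) * e x :=
    Continuous.integrable_of_hasCompactSupport (by fun_prop) (hcs.mul_right)
  have i2 : Integrable fun x => (timeDeriv f x : ℂ) * e x :=
    Continuous.integrable_of_hasCompactSupport (by fun_prop) (hcs'.mul_right)
  have key := integral_mul_fderiv_eq_neg_fderiv_mul_of_integrable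
    (μ := (volume : Measure (Spacetime d))) (f := fun x => (f x : ℂ)) (g := e) (v := event 1 0)
    (by simpa only [hfd] using i2)
    (by
      simp_rw [hea, mul_left_comm _ a]
      exact i1.const_mul a) i1
    (fun x _ => (Complex.ofRealCLM.differentiableAt).comp x (hf.differentiable (by simp) x))
    (fun x _ => he.differentiable (by simp) x)
  simp only [hea, hfd] at key
  rw [neg_mul, eq_neg_iff_add_eq_zero, ← integral_const_mul]
  simp_rw [mul_left_comm _ a] at key
  rw [key]
  ring

/-- On the positive shell the factor is `-iω`. It converts the vector of `f`, carrying a factor `i`,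
into a vector with a real factor `ω`, and thus exchanges the two kinds of Cauchy data. -/
theorem lorentzFourier_timeDeriv {f : Spacetime d → ℝ} (hf : ContDiff ℝ ∞ f)
    (hfc : HasCompactSupport f) (k : Spacetime d) :
    lorentzFourier (fun x => (timeDeriv f x : ℂ)) k =
      -(I * k 0) * lorentzFourier (fun x => (f x : ℂ)) k := by
  have hl : ∀ x, HasFDerivAt (fun x => (lorentz k x : ℂ))
      (Complex.ofRealCLM.comp (k 0 • EuclideanSpace.proj (𝕜 := ℝ) (0 : Fin (d + 1)) -
        (innerSL ℝ (spatial d k)).comp (spatial d))) x := by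
    intro x
    have h1 : (fun x => (lorentz k x : ℂ)) = (Complex.ofRealCLM.comp
        (k 0 • EuclideanSpace.proj (𝕜 := ℝ) (0 : Fin (d + 1)) -
        (innerSL ℝ (spatial d k)).comp (spatial d))) := by
      funext x
      simp only [lorentz_eq, ContinuousLinearMap.comp_apply, sub_apply,
        smul_apply, innerSL_apply_apply, real_inner_comm (spatial d k)]
      simp
    rw [h1]
    exact ContinuousLinearMap.hasFDerivAt _
  have he : ContDiff ℝ 1 fun x => exp (I * (lorentz k x : ℂ)) := by
    have h1 : ContDiff ℝ 1 fun x => lorentz k x := by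
      simp_rw [lorentz_eq]
      exact (contDiff_const.mul (EuclideanSpace.proj (𝕜 := ℝ) (0 : Fin (d + 1))).contDiff).sub
        ((spatial d).contDiff.inner ℝ contDiff_const)
    exact (contDiff_const.mul (Complex.ofRealCLM.contDiff.comp h1)).cexp
  have key := integral_timeDeriv_mul hf hfc he (a := I * k 0) fun x => by
    rw [((hl x).const_mul I).cexp.fderiv]
    simp [show spatial d (event 1 0) = 0 from rfl]
    ring
  rw [lorentzFourier, lorentzFourier, key]
  ring

/-- On the mass shell, Fourier transforms of test functions decay rapidly in the momentum. -/
theorem exists_norm_lorentzFourier_le {f : Spacetime d → ℝ} (hf : ContDiff ℝ ∞ f)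
    (hfc : HasCompactSupport f) :
    ∃ C, ∀ k : Spacetime d, ‖lorentzFourier (fun x => (f x : ℂ)) k‖ ≤
      C * (1 + ‖spatial d k‖) ^ (-((d : ℝ) + 3)) := by
  have hcs : HasCompactSupport (Complex.ofRealCLM ∘ f) := hfc.comp_left rfl
  let F : 𝓢(Spacetime d, ℂ) := hcs.toSchwartzMap (Complex.ofRealCLM.contDiff.comp hf)
  obtain ⟨C, hC⟩ := (schwartzFourier d F).exists_norm_le_one_add_norm_rpow
  refine ⟨C, fun k => ?_⟩
  have h1 := hC k
  have hC0 : 0 ≤ C := nonneg_of_mul_nonneg_left ((norm_nonneg _).trans h1) (by positivity)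
  rw [schwartzFourier_apply] at h1
  refine h1.trans ?_
  have e : -(((d + 1 : ℕ) : ℝ) + 2) = -((d : ℝ) + 3) := by push_cast; ring
  rw [e]
  refine mul_le_mul_of_nonneg_left ?_ hC0
  refine Real.rpow_le_rpow_of_nonpos (by positivity) ?_ (by linarith [Nat.cast_nonneg (α := ℝ) d])
  have h2 : ‖spatial d k‖ ^ 2 ≤ ‖k‖ ^ 2 := by
    have := norm_event_sq (k 0) (spatial d k)
    rw [event_spatial] at this
    nlinarith [sq_nonneg (k 0)]
  have := (pow_le_pow_iff_left₀ (norm_nonneg _) (norm_nonneg _) two_ne_zero).1 h2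
  linarith

theorem continuous_lorentzFourier {f : Spacetime d → ℝ} (hf : ContDiff ℝ ∞ f)
    (hfc : HasCompactSupport f) : Continuous (lorentzFourier fun x => (f x : ℂ)) := by
  have hcs : HasCompactSupport (Complex.ofRealCLM ∘ f) := hfc.comp_left rfl
  let F : 𝓢(Spacetime d, ℂ) := hcs.toSchwartzMap (Complex.ofRealCLM.contDiff.comp hf)
  have : (lorentzFourier fun x => (f x : ℂ)) = schwartzFourier d F :=
    funext fun k => (schwartzFourier_apply F k).symm
  rw [this]
  exact (schwartzFourier d F).continuous

/-- A function that decays rapidly in the momentum belongs to the one-particle space. -/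
theorem memLp_posShell_of_decay (hmd : 0 < m ∨ 2 ≤ d) {c : Spacetime d → ℂ} (hc : Measurable c)
    {C : ℝ} (h : ∀ p : Space d, ‖c (event (energy m p) p)‖ ≤ C * (1 + ‖p‖) ^ (-((d : ℝ) + 1))) :
    MemLp c 2 (posShell d m) := by
  refine memLp_posShell_of_integrable hc ?_
  have hmeas : Measurable fun p : Space d => c (event (energy m p) p) :=
    hc.comp (measurableEmbedding_posShell d m).measurable
  refine ((integrable_decay_div_energy hmd).const_mul (C * C)).mono'
    ((hmeas.norm.pow_const 2).div (measurable_energy m)).aestronglyMeasurable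
    (.of_forall fun p => ?_)
  have hω := energy_nonneg m p
  rw [Real.norm_of_nonneg (by positivity), ← mul_div_assoc]
  have hb : (1 + ‖p‖) ^ (-((d : ℝ) + 1)) ≤ 1 :=
    Real.rpow_le_one_of_one_le_of_nonpos (by linarith [norm_nonneg p])
      (by linarith [Nat.cast_nonneg (α := ℝ) d])
  have hC0 : 0 ≤ C := nonneg_of_mul_nonneg_left ((norm_nonneg _).trans (h p)) (by positivity)
  have hb0 : 0 ≤ (1 + ‖p‖) ^ (-((d : ℝ) + 1)) := by positivity
  gcongr
  calc ‖c (event (energy m p) p)‖ ^ 2 ≤ (C * (1 + ‖p‖) ^ (-((d : ℝ) + 1))) ^ 2 := by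
        gcongr
        exact h p
    _ = C * C * (1 + ‖p‖) ^ (-((d : ℝ) + 1)) * (1 + ‖p‖) ^ (-((d : ℝ) + 1)) := by ring
    _ ≤ C * C * (1 + ‖p‖) ^ (-((d : ℝ) + 1)) * 1 := by gcongr
    _ = _ := by ring

/-- The function on the mass shell that defines the vector generated by the test function `f`. -/
def testFunction (f : Spacetime d → ℝ) (k : Spacetime d) : ℂ :=
  (√(2 * Real.pi) : ℂ) * (I * lorentzFourier (fun x => (f x : ℂ)) k)

theorem measurable_testFunction {f : Spacetime d → ℝ} (hf : ContDiff ℝ ∞ f)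
    (hfc : HasCompactSupport f) : Measurable (testFunction f) :=
  measurable_const.mul (measurable_const.mul (continuous_lorentzFourier hf hfc).measurable)

theorem rpow_decay_mono {a b : ℝ} (hab : a ≤ b) (p : Space d) :
    (1 + ‖p‖) ^ (-b) ≤ (1 + ‖p‖) ^ (-a) :=
  Real.rpow_le_rpow_of_exponent_le (by linarith [norm_nonneg p]) (by linarith)

theorem memLp_testFunction (hmd : 0 < m ∨ 2 ≤ d) {f : Spacetime d → ℝ} (hf : ContDiff ℝ ∞ f)
    (hfc : HasCompactSupport f) : MemLp (testFunction f) 2 (posShell d m) := by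
  obtain ⟨C, hC⟩ := exists_norm_lorentzFourier_le hf hfc
  refine memLp_posShell_of_decay hmd (measurable_testFunction hf hfc)
    (C := √(2 * Real.pi) * C) fun p => ?_
  have hC0 : 0 ≤ C := nonneg_of_mul_nonneg_left ((norm_nonneg _).trans (hC 0)) (by positivity)
  rw [testFunction, norm_mul, norm_mul, norm_real, norm_I, one_mul,
    Real.norm_of_nonneg (Real.sqrt_nonneg _), mul_assoc]
  refine mul_le_mul_of_nonneg_left ((hC _).trans ?_) (Real.sqrt_nonneg _)
  rw [spatial_event]
  exact mul_le_mul_of_nonneg_left (rpow_decay_mono (by linarith) p) hC0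

theorem inner_toLp {a b : Spacetime d → ℂ} (ha : MemLp a 2 (posShell d m))
    (hb : MemLp b 2 (posShell d m)) :
    inner ℂ (ha.toLp a) (hb.toLp b) = ∫ p : Space d, ((1 / (2 * energy m p) : ℝ) : ℂ) *
      (b (event (energy m p) p) * conj (a (event (energy m p) p))) := by
  rw [L2.inner_def]
  have : ∫ k, inner ℂ (ha.toLp a k) (hb.toLp b k) ∂posShell d m =
      ∫ k, b k * conj (a k) ∂posShell d m := by
    refine integral_congr_ae ?_
    filter_upwards [ha.coeFn_toLp, hb.coeFn_toLp] with k h1 h2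
    rw [h1, h2]
    simp
  rw [this, integral_posShell]
  simp only [real_smul]

end Spacetime

/-! ### Shifting the contour in the rapidity -/

section Strip

theorem norm_cosh_sq (θ α : ℝ) :
    ‖cosh ((θ : ℂ) + α * I)‖ ^ 2 = Real.sinh θ ^ 2 + Real.cos α ^ 2 := by
  rw [cosh_add, cosh_mul_I, sinh_mul_I, ← ofReal_cosh, ← ofReal_sinh, ← ofReal_cos, ← ofReal_sin,
    Complex.sq_norm, normSq_apply]
  have h1 := Real.cosh_sq θ
  have h2 := Real.sin_sq_add_cos_sq α
  generalize Real.cosh θ = a at *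
  generalize Real.sinh θ = b at *
  generalize Real.cos α = e at *
  generalize Real.sin α = s at *
  simp
  linear_combination e ^ 2 * h1 + b ^ 2 * h2

theorem abs_sinh_le_norm_cosh (θ α : ℝ) : |Real.sinh θ| ≤ ‖cosh ((θ : ℂ) + α * I)‖ := by
  rw [← pow_le_pow_iff_left₀ (abs_nonneg _) (norm_nonneg _) two_ne_zero, norm_cosh_sq, sq_abs]
  nlinarith [sq_nonneg (Real.cos α)]

theorem integrable_inv_cosh : Integrable fun θ : ℝ => (Real.cosh θ)⁻¹ := by
  refine (integrable_inv_one_add_sq.const_mul 2).mono'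
    (Real.continuous_cosh.inv₀ fun x => (Real.cosh_pos x).ne').aestronglyMeasurable
    (.of_forall fun θ => ?_)
  have h := Real.one_le_cosh θ
  rw [Real.norm_of_nonneg (by positivity), ← div_eq_mul_inv, inv_eq_one_div,
    div_le_div_iff₀ (by positivity) (by positivity)]
  -- This yields `cosh θ ≥ 1 + θ²/2`, hence the constant `2` in the dominating function.
  have h2 : Real.cosh θ = 1 + 2 * Real.sinh (θ / 2) ^ 2 := by
    have := Real.cosh_two_mul (θ / 2)
    rw [mul_div_cancel₀ _ two_ne_zero, Real.cosh_sq] at this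
    linarith
  have h3 : (θ / 2) ^ 2 ≤ Real.sinh (θ / 2) ^ 2 := by
    rw [sq_le_sq]
    rcases le_total 0 (θ / 2) with h4 | h4
    · have := Real.self_le_sinh_iff.2 h4
      rw [abs_of_nonneg h4, abs_of_nonneg (h4.trans this)]
      exact this
    · have := Real.sinh_le_self_iff.2 h4
      rw [abs_of_nonpos h4, abs_of_nonpos (this.trans h4)]
      linarith
  nlinarith

/-- Cauchy's theorem on the strip `-π ≤ Im z ≤ 0`. -/
theorem integral_eq_integral_sub_pi_mul_I {Ψ : ℂ → ℂ} (hΨ : Differentiable ℂ Ψ) {C : ℝ}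
    (hC : ∀ θ α : ℝ, α ∈ Set.Icc (-Real.pi) 0 → ‖Ψ (θ + α * I)‖ * ‖cosh ((θ : ℂ) + α * I)‖ ≤ C) :
    ∫ θ : ℝ, Ψ θ = ∫ θ : ℝ, Ψ (θ - Real.pi * I) := by
  have hpi := Real.pi_pos
  have hC0 : 0 ≤ C := (by positivity : (0 : ℝ) ≤ _).trans (hC 0 0 ⟨by linarith, le_rfl⟩)
  -- Only the lines `α = 0` and `α = -π` are integrated along, and there `|cosh(θ + iα)| = cosh θ`.
  -- Inside the strip `cosh` has a zero, so the hypothesis gives no such bound on every line.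
  have hline : ∀ α : ℝ, α ∈ Set.Icc (-Real.pi) 0 → Real.cos α ^ 2 = 1 →
      Integrable fun θ : ℝ => Ψ (θ + α * I) := by
    intro α hα hcos
    refine (integrable_inv_cosh.const_mul C).mono'
      (hΨ.continuous.comp (by fun_prop)).aestronglyMeasurable (.of_forall fun θ => ?_)
    have h1 := hC θ α hα
    have h2 : ‖cosh ((θ : ℂ) + α * I)‖ = Real.cosh θ := by
      have := norm_cosh_sq θ α
      rw [hcos, ← Real.cosh_sq] at this
      exact (pow_left_inj₀ (norm_nonneg _) (Real.cosh_pos θ).le two_ne_zero).1 this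
    rw [h2] at h1
    rwa [← div_eq_mul_inv, le_div_iff₀ (Real.cosh_pos θ)]
  have hi0 : Integrable fun θ : ℝ => Ψ θ := by
    simpa using hline 0 ⟨by linarith, le_rfl⟩ (by simp)
  have hi1 : Integrable fun θ : ℝ => Ψ (θ + (-Real.pi : ℝ) * I) :=
    hline (-Real.pi) ⟨le_rfl, by linarith⟩ (by simp)
  have ht0 : Tendsto (fun T : ℝ => ∫ θ in (-T)..T, Ψ θ) atTop (𝓝 (∫ θ : ℝ, Ψ θ)) :=
    intervalIntegral_tendsto_integral hi0 tendsto_neg_atTop_atBot tendsto_id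
  have ht1 : Tendsto (fun T : ℝ => ∫ θ in (-T)..T, Ψ (θ + (-Real.pi : ℝ) * I)) atTop
      (𝓝 (∫ θ : ℝ, Ψ (θ + (-Real.pi : ℝ) * I))) :=
    intervalIntegral_tendsto_integral hi1 tendsto_neg_atTop_atBot tendsto_id
  -- The sign `σ` selects the right or the left side of the rectangle; `|cosh| ≥ sinh T` holds on
  -- both, uniformly in the height.
  have hside : ∀ σ : ℝ, |σ| = 1 → Tendsto (fun T : ℝ =>
      I • ∫ y in (-Real.pi)..0, Ψ ((σ * T : ℝ) + y * I)) atTop (𝓝 0) := by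
    intro σ hσ
    have h0 : Tendsto (fun T : ℝ => C / Real.sinh T * |0 - -Real.pi|) atTop (𝓝 0) := by
      have h1 : Tendsto (fun T : ℝ => Real.sinh T) atTop atTop :=
        tendsto_atTop_mono' atTop
          ((eventually_ge_atTop 0).mono fun T hT => Real.self_le_sinh_iff.2 hT) tendsto_id
      simpa using (h1.const_div_atTop C).mul_const |0 - -Real.pi|
    refine squeeze_zero_norm' ?_ h0
    filter_upwards [eventually_gt_atTop 0] with T hT
    rw [norm_smul, norm_I, one_mul]
    refine intervalIntegral.norm_integral_le_of_norm_le_const fun y hy => ?_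
    rw [Set.uIoc_of_le (by linarith)] at hy
    have h1 := hC (σ * T) y ⟨hy.1.le, hy.2⟩
    have h2 := abs_sinh_le_norm_cosh (σ * T) y
    have h3 : |Real.sinh (σ * T)| = Real.sinh T := by
      rw [Real.abs_sinh, abs_mul, hσ, one_mul, abs_of_pos hT]
    rw [h3] at h2
    rw [le_div_iff₀ (Real.sinh_pos_iff.2 hT)]
    exact (mul_le_mul_of_nonneg_left h2 (norm_nonneg _)).trans h1
  have hrect : ∀ T : ℝ, (∫ θ in (-T)..T, Ψ (θ + (-Real.pi : ℝ) * I)) - (∫ θ in (-T)..T, Ψ θ)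
      + I • (∫ y in (-Real.pi)..0, Ψ ((1 * T : ℝ) + y * I))
      - I • (∫ y in (-Real.pi)..0, Ψ ((-1 * T : ℝ) + y * I)) = 0 := by
    intro T
    have := integral_boundary_rect_eq_zero_of_differentiableOn Ψ ⟨-T, -Real.pi⟩ ⟨T, 0⟩
      hΨ.differentiableOn
    simpa using this
  have hlim := ((ht1.sub ht0).add (hside 1 (by simp))).sub (hside (-1) (by simp))
  simp_rw [hrect] at hlim
  have := tendsto_nhds_unique tendsto_const_nhds hlim
  rw [add_zero, sub_zero, eq_comm, sub_eq_zero] at this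
  rw [← this]
  refine integral_congr_ae (.of_forall fun θ => ?_)
  simp [sub_eq_add_neg]

end Strip

/-! ### Causality -/

section Causality

variable {n : ℕ} {m : ℝ}

theorem inner_event (s t : ℝ) (p q : Space n) :
    inner ℝ (event s p) (event t q) = s * t + inner ℝ p q := by
  simp only [PiLp.inner_apply, Fin.sum_univ_succ, event_zero, event_succ]
  simp [mul_comm]

theorem energy_event (s : ℝ) (q : Space n) :
    energy m (event s q) = √(s ^ 2 + energy m q ^ 2) := by
  rw [energy_sq, energy, norm_event_sq]
  congr 1; ring

/-- Here `event` builds a spatial momentum with first component `μ sinh θ` and transverse part `q`,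
where `μ = energy m q`; this is the rapidity parametrization of the mass shell. -/
theorem energy_event_sinh {q : Space n} (θ : ℝ) :
    energy m (event (energy m q * Real.sinh θ) q) = energy m q * Real.cosh θ := by
  rw [energy_event]
  have h : (energy m q * Real.sinh θ) ^ 2 + energy m q ^ 2 = (energy m q * Real.cosh θ) ^ 2 := by
    rw [mul_pow, mul_pow, Real.cosh_sq]; ring
  rw [h, Real.sqrt_sq (mul_nonneg (energy_nonneg m q) (Real.cosh_pos θ).le)]

/-- The phase `p·(x - y)` for the momentum `p` of transverse mass `μ`, rapidity `z` and
transverse momentum `q`, and for `y` at time zero. -/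
def phase (μ : ℝ) (q : Space n) (y : Space (n + 1)) (z : ℂ) (x : Spacetime (n + 1)) : ℂ :=
  μ * cosh z * x 0 - μ * sinh z * ((x 1 - y 0 : ℝ) : ℂ) -
    (inner ℝ (spatial n (spatial (n + 1) x - y)) q : ℝ)

theorem hasDerivAt_phase (μ : ℝ) (q : Space n) (y : Space (n + 1)) (z : ℂ)
    (x : Spacetime (n + 1)) : HasDerivAt (fun z => phase μ q y z x)
      (μ * sinh z * x 0 - μ * cosh z * ((x 1 - y 0 : ℝ) : ℂ)) z := by
  unfold phase
  exact ((((hasDerivAt_cosh z).const_mul _).mul_const _).sub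
    (((hasDerivAt_sinh z).const_mul _).mul_const _)).sub_const _

/-- The exponent has real part `μ(-sin α)(sinh θ · x₀ - cosh θ · (x₁ - y₁))`. It is nonpositive
because `sin α ≤ 0` and `x₁ - y₁ > |x₀|`. -/
theorem norm_exp_phase_le {μ : ℝ} (hμ : 0 ≤ μ) (q : Space n) {y : Space (n + 1)} (hy : y 0 ≤ 0)
    {x : Spacetime (n + 1)} (hx : x ∈ wedge (n + 1)) (θ : ℝ) {α : ℝ}
    (hα : α ∈ Set.Icc (-Real.pi) 0) : ‖exp (I * phase μ q y (θ + α * I) x)‖ ≤ 1 := by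
  have hsin : Real.sin α ≤ 0 := Real.sin_nonpos_of_nonpos_of_neg_pi_le hα.2 hα.1
  have hx' : |x 0| < x 1 := hx
  rw [norm_exp, Real.exp_le_one_iff, phase, cosh_add, sinh_add, cosh_mul_I, sinh_mul_I,
    ← ofReal_cosh, ← ofReal_sinh, ← ofReal_cos, ← ofReal_sin]
  have hre : (I * ((μ : ℂ) * ((Real.cosh θ : ℝ) * (Real.cos α : ℝ) +
      (Real.sinh θ : ℝ) * ((Real.sin α : ℝ) * I)) * (x 0 : ℝ) -
      μ * ((Real.sinh θ : ℝ) * (Real.cos α : ℝ) + (Real.cosh θ : ℝ) * ((Real.sin α : ℝ) * I)) *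
      ((x 1 - y 0 : ℝ) : ℂ) - (inner ℝ (spatial n (spatial (n + 1) x - y)) q : ℝ))).re
      = μ * (-Real.sin α) * (Real.sinh θ * x 0 - Real.cosh θ * (x 1 - y 0)) := by
    generalize Real.cosh θ = a
    generalize Real.sinh θ = b
    generalize Real.cos α = e
    generalize Real.sin α = s
    simp
    ring
  rw [hre]
  refine mul_nonpos_of_nonneg_of_nonpos (mul_nonneg hμ (by linarith)) ?_
  have h1 : Real.sinh θ * x 0 ≤ Real.cosh θ * |x 0| := by
    refine (le_abs_self _).trans ?_
    rw [abs_mul]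
    refine mul_le_mul_of_nonneg_right ?_ (abs_nonneg _)
    rw [Real.abs_sinh, ← Real.cosh_abs]
    exact (Real.sinh_lt_cosh _).le
  have h2 := Real.cosh_pos θ
  nlinarith

/-- The Fourier transform of `f`, translated by `-y`, at complex rapidity `z`. -/
def rapidityFourier (f : Spacetime (n + 1) → ℝ) (μ : ℝ) (q : Space n) (y : Space (n + 1))
    (z : ℂ) : ℂ := ∫ x, (f x : ℂ) * exp (I * phase μ q y z x)

theorem differentiable_rapidityFourier {f : Spacetime (n + 1) → ℝ} (hf : Continuous f)
    (hfc : HasCompactSupport f) (μ : ℝ) (q : Space n) (y : Space (n + 1)) :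
    Differentiable ℂ (rapidityFourier f μ q y) := by
  intro z₀
  have hph : Continuous fun a : ℂ × Spacetime (n + 1) => phase μ q y a.1 a.2 := by
    unfold phase
    fun_prop
  have hph1 : ∀ z, Continuous fun x => phase μ q y z x := by
    intro z
    unfold phase
    fun_prop
  let D : ℂ × Spacetime (n + 1) → ℂ := fun a => exp (I * phase μ q y a.1 a.2) *
    (I * (μ * sinh a.1 * a.2 0 - μ * cosh a.1 * ((a.2 1 - y 0 : ℝ) : ℂ)))
  have hD : Continuous D := by
    have h1 : Continuous fun a : ℂ × Spacetime (n + 1) => exp (I * phase μ q y a.1 a.2) :=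
      (continuous_const.mul hph).cexp
    refine h1.mul ?_
    fun_prop
  -- A bound on a compact neighbourhood times the support of `f` justifies differentiation under the
  -- integral.
  obtain ⟨C, hC⟩ := ((isCompact_closedBall z₀ 1).prod hfc.isCompact).exists_bound_of_continuousOn
    (f := D) hD.continuousOn
  have hint : ∀ {E : Type} [NormedAddCommGroup E], ∀ {u : Spacetime (n + 1) → E}, Continuous u →
      (∀ x, f x = 0 → u x = 0) → Integrable u := fun hu h0 =>
    hu.integrable_of_hasCompactSupport (hfc.mono' fun x hx => subset_tsupport _ fun h => hx (h0 x h))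
  have key := hasDerivAt_integral_of_dominated_loc_of_deriv_le (μ := volume)
    (F := fun z x => (f x : ℂ) * exp (I * phase μ q y z x))
    (F' := fun z x => (f x : ℂ) * D (z, x)) (bound := fun x => C * ‖f x‖) (x₀ := z₀)
    (s := Metric.closedBall z₀ 1) (Metric.closedBall_mem_nhds z₀ one_pos)
    (.of_forall fun z => Continuous.aestronglyMeasurable (by have := hph1 z; fun_prop))
    (hint (by have := hph1 z₀; fun_prop) fun x hx => by simp [hx])
    (Continuous.aestronglyMeasurable (by fun_prop))
    (.of_forall fun x z hz => by
      by_cases hx : x ∈ tsupport f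
      · rw [norm_mul, norm_real, mul_comm]
        exact mul_le_mul_of_nonneg_right (hC (z, x) ⟨hz, hx⟩) (norm_nonneg _)
      · simp [image_eq_zero_of_notMem_tsupport hx])
    (hint (by fun_prop) fun x hx => by simp [hx])
    (.of_forall fun x z hz =>
      (((hasDerivAt_phase μ q y z x).const_mul I).cexp.const_mul (f x : ℂ)))
  exact key.2.differentiableAt

theorem rapidityFourier_timeDeriv {f : Spacetime (n + 1) → ℝ} (hf : ContDiff ℝ ∞ f)
    (hfc : HasCompactSupport f) (μ : ℝ) (q : Space n) (y : Space (n + 1)) (z : ℂ) :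
    rapidityFourier (timeDeriv f) μ q y z = -(I * (μ * cosh z)) * rapidityFourier f μ q y z := by
  let ℓ : Spacetime (n + 1) →L[ℝ] ℂ :=
    (μ * cosh z) • (Complex.ofRealCLM.comp (EuclideanSpace.proj (𝕜 := ℝ) (0 : Fin (n + 1 + 1)))) -
    (μ * sinh z) • (Complex.ofRealCLM.comp (EuclideanSpace.proj (𝕜 := ℝ) (1 : Fin (n + 1 + 1)))) -
    Complex.ofRealCLM.comp ((innerSL ℝ q).comp ((spatial n).comp (spatial (n + 1))))
  have hℓ : ∀ x, phase μ q y z x = ℓ x + (μ * sinh z * y 0 + (inner ℝ (spatial n y) q : ℝ)) := by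
    intro x
    simp only [phase, ℓ, map_sub, inner_sub_left]
    simp [real_inner_comm q]
    ring
  refine integral_timeDeriv_mul hf hfc ?_ fun x => ?_
  · simp_rw [hℓ]
    exact (contDiff_const.mul (ℓ.contDiff.add contDiff_const)).cexp
  · simp_rw [hℓ]
    rw [((ℓ.hasFDerivAt.add_const _).const_mul I).cexp.fderiv]
    have h1 : (event 1 0 : Spacetime (n + 1)) 1 = 0 := rfl
    simp [ℓ, h1]
    ring

/-- The time derivative of `f` is again supported in the wedge, so its transform is bounded on the
strip; it equals that of `f` times `-iμ cosh z`, which gives the decay needed to move the contour.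
-/
theorem norm_rapidityFourier_mul_le {f : Spacetime (n + 1) → ℝ} (hf : ContDiff ℝ ∞ f)
    (hfc : HasCompactSupport f) (hfW : tsupport f ⊆ wedge (n + 1)) {μ : ℝ} (hμ : 0 < μ)
    (q : Space n) {y : Space (n + 1)} (hy : y 0 ≤ 0) (θ : ℝ) {α : ℝ}
    (hα : α ∈ Set.Icc (-Real.pi) 0) :
    ‖rapidityFourier f μ q y (θ + α * I)‖ * ‖cosh ((θ : ℂ) + α * I)‖ ≤
      (∫ x, ‖timeDeriv f x‖) / μ := by
  have h1 := congrArg norm (rapidityFourier_timeDeriv hf hfc μ q y (θ + α * I))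
  rw [norm_mul, norm_neg, norm_mul, norm_I, one_mul, norm_mul, norm_real,
    Real.norm_of_nonneg hμ.le] at h1
  rw [le_div_iff₀ hμ]
  calc _ = ‖rapidityFourier (timeDeriv f) μ q y (θ + α * I)‖ := by rw [h1]; ring
    _ ≤ _ := by
      refine norm_integral_le_of_norm_le
        ((contDiff_timeDeriv hf).continuous.integrable_of_hasCompactSupport
          (hasCompactSupport_timeDeriv hfc)).norm (.of_forall fun x => ?_)
      by_cases hx : x ∈ tsupport f
      · rw [norm_mul, norm_real]
        exact mul_le_of_le_one_right (norm_nonneg _)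
          (norm_exp_phase_le hμ.le q hy (hfW hx) θ hα)
      · have : timeDeriv f x = 0 :=
          image_eq_zero_of_notMem_tsupport fun h => hx (tsupport_timeDeriv_subset f h)
        simp [this]

/-- The shift reverses the signs of `cosh` and `sinh` but not that of the transverse term, whereas
conjugation reverses the whole phase. The replacement `q ↦ -q` makes up the difference. -/
theorem rapidityFourier_sub_pi_mul_I (f : Spacetime (n + 1) → ℝ) (μ : ℝ) (q : Space n)
    (y : Space (n + 1)) (θ : ℝ) :
    rapidityFourier f μ q y (θ - Real.pi * I) = conj (rapidityFourier f μ (-q) y θ) := by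
  rw [rapidityFourier, rapidityFourier, ← integral_conj]
  refine integral_congr_ae (.of_forall fun x => ?_)
  simp only [map_mul, conj_ofReal, ← exp_conj, conj_I, phase, map_sub, ← ofReal_cosh,
    ← ofReal_sinh, inner_neg_right]
  congr 2
  rw [cosh_sub, sinh_sub, cosh_mul_I, sinh_mul_I]
  simp
  ring

theorem integral_rapidityFourier {f : Spacetime (n + 1) → ℝ} (hf : ContDiff ℝ ∞ f)
    (hfc : HasCompactSupport f) (hfW : tsupport f ⊆ wedge (n + 1)) {μ : ℝ} (hμ : 0 < μ)
    (q : Space n) {y : Space (n + 1)} (hy : y 0 ≤ 0) :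
    ∫ θ : ℝ, rapidityFourier f μ q y θ = conj (∫ θ : ℝ, rapidityFourier f μ (-q) y θ) := by
  rw [integral_eq_integral_sub_pi_mul_I
    (differentiable_rapidityFourier hf.continuous hfc μ q y)
    (fun θ α hα => norm_rapidityFourier_mul_le hf hfc hfW hμ q hy θ hα), ← integral_conj]
  exact integral_congr_ae (.of_forall fun θ => rapidityFourier_sub_pi_mul_I f μ q y θ)

end Causality

/-! ### Reality of the commutator integral -/

section Commutator

variable {n : ℕ} {m : ℝ}

theorem lorentzFourier_mul_exp (f : Spacetime (n + 1) → ℝ) (μ : ℝ) (q : Space n)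
    (y : Space (n + 1)) (θ : ℝ) :
    lorentzFourier (fun x => (f x : ℂ)) (event (μ * Real.cosh θ) (event (μ * Real.sinh θ) q)) *
      exp (I * (inner ℝ y (event (μ * Real.sinh θ) q) : ℂ)) =
      fourierConst (n + 1) * rapidityFourier f μ q y θ := by
  rw [lorentzFourier, rapidityFourier, mul_assoc, ← integral_mul_const]
  congr 1
  refine integral_congr_ae (.of_forall fun x => ?_)
  have h : ∀ w : Space (n + 1), inner ℝ w (event (μ * Real.sinh θ) q) =
      w 0 * (μ * Real.sinh θ) + inner ℝ (spatial n w) q := fun w => by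
    conv_lhs => rw [← event_spatial w]
    exact inner_event _ _ _ _
  simp only [lorentz_eq, event_zero, spatial_event, mul_assoc, ← exp_add]
  congr 2
  rw [phase, h, h, map_sub, inner_sub_left]
  have h1 : spatial (n + 1) x 0 = x 1 := rfl
  rw [h1]
  push_cast
  ring

theorem integral_comp_mul_sinh {μ : ℝ} (hμ : 0 < μ) (φ : ℝ → ℂ) :
    ∫ s, φ s = ∫ θ : ℝ, ((μ * Real.cosh θ : ℝ) : ℂ) * φ (μ * Real.sinh θ) := by
  have h := integral_image_eq_integral_abs_deriv_smul (s := Set.univ)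
    (f := fun θ => μ * Real.sinh θ) (f' := fun θ => μ * Real.cosh θ) MeasurableSet.univ
    (fun θ _ => ((Real.hasDerivAt_sinh θ).const_mul μ).hasDerivWithinAt)
    (fun a _ b _ hab => Real.sinh_injective (mul_left_cancel₀ hμ.ne' hab)) φ
  have himg : (fun θ => μ * Real.sinh θ) '' Set.univ = Set.univ := by
    rw [Set.image_univ, Set.range_eq_univ]
    intro s
    obtain ⟨θ, hθ⟩ := Real.sinh_surjective (s / μ)
    exact ⟨θ, by simp only [hθ]; field_simp⟩
  rw [himg, Measure.restrict_univ] at h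
  rw [h]
  refine integral_congr_ae (.of_forall fun θ => ?_)
  have : 0 < μ * Real.cosh θ := mul_pos hμ (Real.cosh_pos θ)
  simp only [abs_of_pos this, real_smul]

/-- The integrand of the commutator of the waves generated by `f` and `g`. -/
def commutatorDensity {d : ℕ} (m : ℝ) (f : Spacetime d → ℝ) (g : Space d → ℝ) (p : Space d) : ℂ :=
  ((1 / (2 * energy m p) : ℝ) : ℂ) *
    (lorentzFourier (fun x => (f x : ℂ)) (event (energy m p) p) * spaceFourier g p)

theorem integral_commutatorDensity_event {f : Spacetime (n + 1) → ℝ} (hf : ContDiff ℝ ∞ f)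
    (hfc : HasCompactSupport f) (hfW : tsupport f ⊆ wedge (n + 1)) {g : Space (n + 1) → ℝ}
    (hg : Continuous g) (hgi : Integrable g) {q : Space n}
    (hq : 0 < energy m q) :
    ∫ s : ℝ, commutatorDensity m f g (event s q) = fourierConst (n + 1) / 2 *
      ∫ y, (g y : ℂ) * ∫ θ : ℝ, rapidityFourier f (energy m q) q y θ := by
  set μ := energy m q with hμdef
  let K : ℝ → Space (n + 1) → ℂ := fun θ y => (g y : ℂ) *
    (lorentzFourier (fun x => (f x : ℂ)) (event (μ * Real.cosh θ) (event (μ * Real.sinh θ) q)) *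
      exp (I * (inner ℝ y (event (μ * Real.sinh θ) q) : ℂ)))
  have hLc := continuous_lorentzFourier hf hfc
  have hev : Continuous fun θ : ℝ => (event (μ * Real.sinh θ) q : Space (n + 1)) :=
    continuous_event.comp ((continuous_const.mul Real.continuous_sinh).prodMk continuous_const)
  have hev2 : Continuous fun θ : ℝ =>
      (event (μ * Real.cosh θ) (event (μ * Real.sinh θ) q) : Spacetime (n + 1)) :=
    continuous_event.comp ((continuous_const.mul Real.continuous_cosh).prodMk hev)
  have hKc : Continuous (Function.uncurry K) := by
    have h1 : Continuous fun a : ℝ × Space (n + 1) => lorentzFourier (fun x => (f x : ℂ))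
        (event (μ * Real.cosh a.1) (event (μ * Real.sinh a.1) q)) :=
      (hLc.comp hev2).comp continuous_fst
    have h2 : Continuous fun a : ℝ × Space (n + 1) =>
        (inner ℝ a.2 (event (μ * Real.sinh a.1) q : Space (n + 1)) : ℝ) :=
      continuous_snd.inner (hev.comp continuous_fst)
    exact (continuous_ofReal.comp (hg.comp continuous_snd)).mul
      (h1.mul (continuous_const.mul (continuous_ofReal.comp h2)).cexp)
  have hKint : Integrable (Function.uncurry K) := by
    have h1 := (integrable_inv_cosh.const_mul
      (|fourierConst (n + 1)| * ((∫ x, ‖timeDeriv f x‖) / μ))).mul_prod hgi.norm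
    refine h1.mono' hKc.aestronglyMeasurable (.of_forall fun a => ?_)
    simp only [Function.uncurry, K, norm_mul, norm_exp_I_mul, mul_one, norm_real]
    rw [mul_comm]
    refine mul_le_mul_of_nonneg_right ?_ (norm_nonneg _)
    -- The modulus of the kernel depends on `y` only through `g`, so the decay at `y = 0` on the
    -- real line suffices.
    have h2 := norm_rapidityFourier_mul_le hf hfc hfW hq q (y := 0) (by simp) a.1 (α := 0)
      ⟨by linarith [Real.pi_pos], le_rfl⟩
    have h3 := congrArg norm (lorentzFourier_mul_exp f μ q 0 a.1)
    rw [norm_mul, norm_exp_I_mul, mul_one, norm_mul, norm_real, Real.norm_eq_abs] at h3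
    rw [h3, mul_assoc]
    refine mul_le_mul_of_nonneg_left ?_ (abs_nonneg _)
    rw [← div_eq_mul_inv, le_div_iff₀ (Real.cosh_pos _)]
    simpa [← ofReal_cosh, abs_of_pos (Real.cosh_pos _)] using h2
  have e1 : ∀ θ : ℝ, ((μ * Real.cosh θ : ℝ) : ℂ) *
      commutatorDensity m f g (event (μ * Real.sinh θ) q) = (1 / 2) * ∫ y, K θ y := by
    intro θ
    have hc : ((μ * Real.cosh θ : ℝ) : ℂ) ≠ 0 := by
      exact_mod_cast (mul_pos hq (Real.cosh_pos θ)).ne'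
    have e2 : ∫ y, K θ y = lorentzFourier (fun x => (f x : ℂ))
        (event (μ * Real.cosh θ) (event (μ * Real.sinh θ) q)) *
        spaceFourier g (event (μ * Real.sinh θ) q) := by
      rw [spaceFourier, ← integral_const_mul]
      refine integral_congr_ae (.of_forall fun y => ?_)
      simp only [K]
      ring
    rw [e2, commutatorDensity, energy_event_sinh, ← hμdef, ← mul_assoc]
    congr 1
    push_cast at hc ⊢
    field_simp
    rw [div_self hc]
  rw [integral_comp_mul_sinh hq]
  simp_rw [e1]
  rw [integral_const_mul, integral_integral_swap hKint, ← integral_const_mul, ← integral_const_mul]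
  refine integral_congr_ae (.of_forall fun y => ?_)
  simp only [K, lorentzFourier_mul_exp]
  rw [integral_const_mul, integral_const_mul]
  ring

theorem integral_commutatorDensity_event_neg {f : Spacetime (n + 1) → ℝ} (hf : ContDiff ℝ ∞ f)
    (hfc : HasCompactSupport f) (hfW : tsupport f ⊆ wedge (n + 1)) {g : Space (n + 1) → ℝ}
    (hg : Continuous g) (hgi : Integrable g) (hgs : ∀ y, g y ≠ 0 → y 0 ≤ 0) {q : Space n}
    (hq : 0 < energy m q) :
    ∫ s : ℝ, commutatorDensity m f g (event s (-q)) =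
      conj (∫ s : ℝ, commutatorDensity m f g (event s q)) := by
  rw [integral_commutatorDensity_event hf hfc hfW hg hgi hq,
    integral_commutatorDensity_event hf hfc hfW hg hgi (by simpa using hq), map_mul,
    ← integral_conj]
  congr 1
  · have h2 : conj (2 : ℂ) = 2 := map_ofNat _ 2
    simp [h2]
  · refine integral_congr_ae (.of_forall fun y => ?_)
    by_cases hy : g y = 0
    · simp [hy]
    · simp only [map_mul, conj_ofReal, energy_neg]
      rw [integral_rapidityFourier hf hfc hfW hq (-q) (hgs y hy), neg_neg]

theorem exists_norm_spaceFourier_le {d : ℕ} (g : 𝓢(Space d, ℝ)) :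
    ∃ C, ∀ p, ‖spaceFourier g p‖ ≤ C * (1 + ‖p‖) ^ (-((d : ℝ) + 2)) := by
  obtain ⟨F, hF⟩ := exists_schwartz_spaceFourier g
  simp_rw [← hF]
  exact F.exists_norm_le_one_add_norm_rpow

theorem continuous_spaceFourier {d : ℕ} (g : 𝓢(Space d, ℝ)) : Continuous (spaceFourier g) := by
  obtain ⟨F, hF⟩ := exists_schwartz_spaceFourier g
  rw [show spaceFourier g = F from funext fun p => (hF p).symm]
  exact F.continuous

theorem integrable_commutatorDensity {d : ℕ} (hmd : 0 < m ∨ 2 ≤ d) {f : Spacetime d → ℝ}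
    (hf : ContDiff ℝ ∞ f) (hfc : HasCompactSupport f) (g : 𝓢(Space d, ℝ)) :
    Integrable (commutatorDensity m f g) := by
  obtain ⟨C, hC⟩ := exists_norm_lorentzFourier_le hf hfc
  obtain ⟨C', hC'⟩ := exists_norm_spaceFourier_le g
  have hC0 : 0 ≤ C := nonneg_of_mul_nonneg_left ((norm_nonneg _).trans (hC 0)) (by positivity)
  have hC0' : 0 ≤ C' := nonneg_of_mul_nonneg_left ((norm_nonneg _).trans (hC' 0)) (by positivity)
  have hmeas : Measurable (commutatorDensity m f g) := by
    refine Measurable.mul (by fun_prop) (Measurable.mul ?_ (continuous_spaceFourier g).measurable)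
    exact (continuous_lorentzFourier hf hfc).measurable.comp
      (measurableEmbedding_posShell d m).measurable
  refine ((integrable_decay_div_energy hmd).const_mul (C * C')).mono' hmeas.aestronglyMeasurable
    (.of_forall fun p => ?_)
  have hω := energy_nonneg m p
  have h1 : ‖lorentzFourier (fun x => (f x : ℂ)) (event (energy m p) p)‖ ≤ C :=
    (hC _).trans (mul_le_of_le_one_right hC0
      (Real.rpow_le_one_of_one_le_of_nonpos (by linarith [norm_nonneg (spatial d (event (energy m p) p))])
        (by linarith [Nat.cast_nonneg (α := ℝ) d])))
  have h2 : ‖spaceFourier g p‖ ≤ C' * (1 + ‖p‖) ^ (-((d : ℝ) + 1)) :=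
    (hC' p).trans (mul_le_mul_of_nonneg_left (rpow_decay_mono (by linarith) p) hC0')
  rw [commutatorDensity, norm_mul, norm_mul, norm_real, Real.norm_of_nonneg (by positivity)]
  calc _ ≤ 1 / (1 * energy m p) * (C * (C' * (1 + ‖p‖) ^ (-((d : ℝ) + 1)))) := by
        gcongr ?_ * (?_ * ?_)
        rcases hω.eq_or_lt with h | h
        · simp [← h]
        · gcongr
          norm_num
    _ = _ := by rw [one_mul]; ring

/-- Einstein causality for the wedge and the opposite time zero half-space. -/
theorem im_integral_commutatorDensity {d : ℕ} [NeZero d] (hmd : 0 < m ∨ 2 ≤ d)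
    {f : Spacetime d → ℝ} (hf : ContDiff ℝ ∞ f) (hfc : HasCompactSupport f)
    (hfW : tsupport f ⊆ wedge d) (g : 𝓢(Space d, ℝ)) (hgs : ∀ y, g y ≠ 0 → y 0 ≤ 0) :
    (∫ p, commutatorDensity m f g p).im = 0 := by
  obtain ⟨n, rfl⟩ : ∃ n, d = n + 1 := ⟨d - 1, (Nat.succ_pred_eq_of_ne_zero (NeZero.ne d)).symm⟩
  have hint := integrable_commutatorDensity hmd hf hfc g
  have e1 : ∫ p, commutatorDensity m f g p =
      ∫ q : Space n, ∫ s : ℝ, commutatorDensity m f g (event s q) := by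
    rw [integral_event (d := n)]
    exact integral_prod_symm _ ((integrable_event (d := n)).2 hint)
  -- Conjugation of the inner integral is compensated by the substitution `q ↦ -q` in the outer one.
  have e2 : conj (∫ p, commutatorDensity m f g p) = ∫ p, commutatorDensity m f g p := by
    rw [e1, ← integral_conj, ← integral_neg_eq_self]
    refine integral_congr_ae ?_
    -- The transverse space has dimension `n = d - 1`. For `m = 0` it must be at least one for the
    -- transverse energy to be positive almost everywhere.
    have hmd' : 0 < m ∨ 1 ≤ n := hmd.imp_right fun h => by omega
    filter_upwards [ae_energy_pos' hmd'] with q hq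
    rw [integral_commutatorDensity_event_neg hf hfc hfW g.continuous g.integrable hgs hq, conj_conj]
  exact conj_eq_iff_im.1 e2

end Commutator

/-! ### Supports of distributions -/

section Support

variable {E : Type*} [NormedAddCommGroup E] [NormedSpace ℝ E]

open scoped Manifold in
/-- A distribution vanishes on the test functions supported off its support. -/
theorem eq_zero_of_disjoint_dsupport [FiniteDimensional ℝ E] (T : 𝓢(E, ℝ) →+ ℝ) {g : 𝓢(E, ℝ)}
    (hg : HasCompactSupport g) (h : Disjoint (tsupport g) (Distribution.dsupport T)) :
    T g = 0 := by
  have hx : ∀ x : tsupport g, ∃ s : Set E,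
      Distribution.IsVanishingOn T s ∧ IsOpen s ∧ (x : E) ∈ s := fun x =>
    (Distribution.notMem_dsupport_iff _).1 (Set.disjoint_left.1 h x.2)
  choose U hU1 hU2 hU3 using hx
  -- A partition of unity subordinate to open sets on which `T` vanishes cuts `g` into pieces,
  -- finitely many of them nonzero by compactness. Additivity of `T` is all that is then used.
  obtain ⟨ρ, hρ⟩ := SmoothPartitionOfUnity.exists_isSubordinate 𝓘(ℝ, E)
    (isClosed_tsupport g) U hU2 fun x hx => Set.mem_iUnion.2 ⟨⟨x, hx⟩, hU3 ⟨x, hx⟩⟩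
  have hfin := ρ.locallyFinite.finite_nonempty_inter_compact hg.isCompact
  have hsm : ∀ i, ContDiff ℝ ∞ fun x => ρ i x * g x := fun i =>
    (ρ i).contMDiff.contDiff.mul (g.smooth ⊤)
  have hcs : ∀ i, HasCompactSupport fun x => ρ i x * g x := fun i => hg.mul_left
  let G : tsupport g → 𝓢(E, ℝ) := fun i => (hcs i).toSchwartzMap (hsm i)
  have hG : ∀ i x, G i x = ρ i x * g x := fun i x => rfl
  have hsum : g = ∑ i ∈ hfin.toFinset, G i := by
    ext x
    rw [_root_.sum_apply]
    simp_rw [hG]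
    rw [← Finset.sum_mul]
    by_cases hx : x ∈ tsupport g
    · have h1 := ρ.sum_eq_one hx
      rw [finsum_eq_sum_of_support_subset (s := hfin.toFinset) _ ?_] at h1
      · rw [h1, one_mul]
      · intro i hi
        simp only [Set.Finite.coe_toFinset]
        exact ⟨x, hi, hx⟩
    · rw [image_eq_zero_of_notMem_tsupport hx, mul_zero]
  rw [hsum, map_sum]
  refine Finset.sum_eq_zero fun i _ => hU1 i (G i) ?_
  exact (tsupport_mul_subset_left (f := ρ i) (g := g)).trans (hρ i)

theorem dsupport_subset_of_forall {T : 𝓢(E, ℝ) → ℝ} {s : Set E} (hs : IsClosed s)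
    (h : ∀ g : 𝓢(E, ℝ), tsupport g ⊆ sᶜ → T g = 0) : Distribution.dsupport T ⊆ s := by
  intro x hx
  exact (Distribution.mem_dsupport_iff x).1 hx s h hs

end Support

/-! ### Cauchy data as functionals on the one-particle space -/

section CauchyData

variable {d : ℕ} {m : ℝ}

theorem spaceFourier_add (g₁ g₂ : 𝓢(Space d, ℝ)) (p : Space d) :
    spaceFourier (g₁ + g₂ : 𝓢(Space d, ℝ)) p = spaceFourier g₁ p + spaceFourier g₂ p := by
  have hint : ∀ g : 𝓢(Space d, ℝ),
      Integrable fun x => (g x : ℂ) * exp (I * (inner ℝ x p : ℂ)) := fun g =>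
    (g.integrable (μ := volume)).ofReal.mul_bdd (c := 1)
      (Continuous.aestronglyMeasurable (by fun_prop))
      (.of_forall fun p => (norm_exp_I_mul _).le)
  rw [spaceFourier, spaceFourier, spaceFourier, ← integral_add (hint g₁) (hint g₂)]
  refine integral_congr_ae (.of_forall fun x => ?_)
  simp [add_mul]

/-- The function on the mass shell that represents the time zero value of the wave tested
with `g`. -/
def valueSymbol (g : 𝓢(Space d, ℝ)) (k : Spacetime d) : ℂ := conj (spaceFourier g (spatial d k))

/-- The function on the mass shell that represents the time derivative at time zero of the wave
tested with `g`. -/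
def derivSymbol (g : 𝓢(Space d, ℝ)) (k : Spacetime d) : ℂ :=
  conj ((k 0 : ℂ) * spaceFourier g (spatial d k))

theorem memLp_valueSymbol (hmd : 0 < m ∨ 2 ≤ d) (g : 𝓢(Space d, ℝ)) :
    MemLp (valueSymbol g) 2 (posShell d m) := by
  obtain ⟨C, hC⟩ := exists_norm_spaceFourier_le g
  have hC0 : 0 ≤ C := nonneg_of_mul_nonneg_left ((norm_nonneg _).trans (hC 0)) (by positivity)
  have := continuous_spaceFourier g
  refine memLp_posShell_of_decay hmd (Continuous.measurable ?_) (C := C) fun p => ?_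
  · unfold valueSymbol
    exact continuous_conj.comp (this.comp (spatial d).continuous)
  · rw [valueSymbol, RCLike.norm_conj, spatial_event]
    exact (hC p).trans (mul_le_mul_of_nonneg_left (rpow_decay_mono (by linarith) p) hC0)

theorem memLp_derivSymbol (hmd : 0 < m ∨ 2 ≤ d) (g : 𝓢(Space d, ℝ)) :
    MemLp (derivSymbol g) 2 (posShell d m) := by
  obtain ⟨C, hC⟩ := exists_norm_spaceFourier_le g
  have hC0 : 0 ≤ C := nonneg_of_mul_nonneg_left ((norm_nonneg _).trans (hC 0)) (by positivity)
  have := continuous_spaceFourier g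
  refine memLp_posShell_of_decay hmd (Continuous.measurable ?_) (C := (1 + |m|) * C) fun p => ?_
  · unfold derivSymbol
    refine continuous_conj.comp (Continuous.mul (by fun_prop) (this.comp (spatial d).continuous))
  · rw [derivSymbol, RCLike.norm_conj, spatial_event, norm_mul, event_zero, norm_real,
      Real.norm_of_nonneg (energy_nonneg m p)]
    have e : (1 + ‖p‖) ^ (-((d : ℝ) + 1)) = (1 + ‖p‖) ^ (-((d : ℝ) + 2)) * (1 + ‖p‖) := by
      rw [← Real.rpow_add_one (by positivity)]
      congr 1; ring
    have h2 : energy m p ≤ (1 + |m|) * (1 + ‖p‖) := by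
      have := energy_le m p
      nlinarith [mul_nonneg (norm_nonneg p) (abs_nonneg m)]
    calc energy m p * ‖spaceFourier g p‖
        ≤ ((1 + |m|) * (1 + ‖p‖)) * (C * (1 + ‖p‖) ^ (-((d : ℝ) + 2))) := by
          gcongr
          exact hC p
      _ = _ := by rw [e]; ring

/-- The factor `2` accounts for `dp/ω` against `dp/2ω`. -/
theorem cauchyValue_eq_inner (hmd : 0 < m ∨ 2 ≤ d) {C : Spacetime d → ℂ}
    (hC : MemLp C 2 (posShell d m)) (g : 𝓢(Space d, ℝ)) :
    cauchyValue m C g =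
      2 * fourierConst d * (inner ℂ ((memLp_valueSymbol hmd g).toLp _) (hC.toLp C)).re := by
  have e : ∫ p : Space d, C (event (energy m p) p) * spaceFourier g p / (energy m p : ℂ) =
      ((2 : ℝ) : ℂ) * inner ℂ ((memLp_valueSymbol hmd g).toLp _) (hC.toLp C) := by
    rw [inner_toLp, ← integral_const_mul]
    refine integral_congr_ae (.of_forall fun p => ?_)
    simp only [valueSymbol, conj_conj, spatial_event, one_div, mul_inv]
    push_cast
    ring
  have e2 : cauchyValue m C g = fourierConst d *
    (∫ p : Space d, C (event (energy m p) p) * spaceFourier g p / (energy m p : ℂ)).re := rfl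
  rw [e2, e, re_ofReal_mul]
  ring

theorem cauchyDeriv_eq_inner [NeZero d] (hmd : 0 < m ∨ 2 ≤ d) {C : Spacetime d → ℂ}
    (hC : MemLp C 2 (posShell d m)) (g : 𝓢(Space d, ℝ)) :
    cauchyDeriv m C g =
      2 * fourierConst d * (inner ℂ ((memLp_derivSymbol hmd g).toLp _) (hC.toLp C)).im := by
  have e : ∫ p : Space d, C (event (energy m p) p) * spaceFourier g p =
      ((2 : ℝ) : ℂ) * inner ℂ ((memLp_derivSymbol hmd g).toLp _) (hC.toLp C) := by
    rw [inner_toLp, ← integral_const_mul]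
    refine integral_congr_ae ?_
    filter_upwards [ae_energy_pos m] with p hp
    have hp' : (energy m p : ℂ) ≠ 0 := by exact_mod_cast hp.ne'
    simp only [derivSymbol, conj_conj, spatial_event, event_zero]
    push_cast
    field_simp
  have e2 : cauchyDeriv m C g = fourierConst d *
    (∫ p : Space d, C (event (energy m p) p) * spaceFourier g p).im := rfl
  rw [e2, e, im_ofReal_mul]
  ring

theorem cauchyValue_add (hmd : 0 < m ∨ 2 ≤ d) {C : Spacetime d → ℂ}
    (hC : MemLp C 2 (posShell d m)) (g₁ g₂ : 𝓢(Space d, ℝ)) :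
    cauchyValue m C (g₁ + g₂) = cauchyValue m C g₁ + cauchyValue m C g₂ := by
  have h : (memLp_valueSymbol (m := m) hmd (g₁ + g₂)).toLp _ =
      (memLp_valueSymbol hmd g₁).toLp _ + (memLp_valueSymbol hmd g₂).toLp _ := by
    rw [← MemLp.toLp_add]
    refine MemLp.toLp_congr _ _ (.of_forall fun k => ?_)
    simp only [Pi.add_apply, valueSymbol, spaceFourier_add, map_add]
  rw [cauchyValue_eq_inner hmd hC, cauchyValue_eq_inner hmd hC, cauchyValue_eq_inner hmd hC, h,
    inner_add_left, add_re]
  ring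

theorem cauchyDeriv_add [NeZero d] (hmd : 0 < m ∨ 2 ≤ d) {C : Spacetime d → ℂ}
    (hC : MemLp C 2 (posShell d m)) (g₁ g₂ : 𝓢(Space d, ℝ)) :
    cauchyDeriv m C (g₁ + g₂) = cauchyDeriv m C g₁ + cauchyDeriv m C g₂ := by
  have h : (memLp_derivSymbol (m := m) hmd (g₁ + g₂)).toLp _ =
      (memLp_derivSymbol hmd g₁).toLp _ + (memLp_derivSymbol hmd g₂).toLp _ := by
    rw [← MemLp.toLp_add]
    refine MemLp.toLp_congr _ _ (.of_forall fun k => ?_)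
    simp only [Pi.add_apply, derivSymbol, spaceFourier_add, map_add, mul_add]
  rw [cauchyDeriv_eq_inner hmd hC, cauchyDeriv_eq_inner hmd hC, cauchyDeriv_eq_inner hmd hC, h,
    inner_add_left, add_im]
  ring

end CauchyData

/-! ### Waves localized in the wedge have localized Cauchy data -/

section Wedge

variable {d : ℕ} {m : ℝ}

theorem isClosed_halfSpace [NeZero d] : IsClosed (halfSpace d) :=
  isClosed_le continuous_const (by fun_prop)

theorem apply_zero_nonpos_of_tsupport [NeZero d] {g : 𝓢(Space d, ℝ)} (hg : tsupport g ⊆ (halfSpace d)ᶜ) (y)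
    (hy : g y ≠ 0) : y 0 ≤ 0 := by
  have h1 := hg (subset_tsupport _ hy)
  simp only [halfSpace, Set.mem_compl_iff, Set.mem_ofPred_eq, not_le] at h1
  exact h1.le

theorem eq_toLp_testFunction (hmd : 0 < m ∨ 2 ≤ d) {f : Spacetime d → ℝ} (hf : ContDiff ℝ ∞ f)
    (hfc : HasCompactSupport f) {v : OneParticle d m} (hv : v =ᵐ[posShell d m] testFunction f) :
    v = (memLp_testFunction hmd hf hfc).toLp _ :=
  Lp.ext (hv.trans (MemLp.coeFn_toLp _).symm)

/-- The factor `i` in the generators turns the real part into the imaginary part of a commutator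
integral, which vanishes by causality. -/
theorem re_inner_valueSymbol [NeZero d] (hmd : 0 < m ∨ 2 ≤ d) {g : 𝓢(Space d, ℝ)}
    (hg : tsupport g ⊆ (halfSpace d)ᶜ) {v : OneParticle d m}
    (hv : v ∈ testVectors d m (wedge d)) :
    (inner ℂ ((memLp_valueSymbol hmd g).toLp _) v).re = 0 := by
  obtain ⟨f, hf, hfc, hfW, hv⟩ := hv
  rw [eq_toLp_testFunction hmd hf hfc hv, inner_toLp]
  have e : ∀ p : Space d, ((1 / (2 * energy m p) : ℝ) : ℂ) *
      (testFunction f (event (energy m p) p) * conj (valueSymbol g (event (energy m p) p))) =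
      ((√(2 * Real.pi) : ℝ) : ℂ) * (I * commutatorDensity m f g p) := by
    intro p
    simp only [valueSymbol, conj_conj, spatial_event, testFunction, commutatorDensity]
    ring
  simp_rw [e]
  rw [integral_const_mul, integral_const_mul, re_ofReal_mul, I_mul_re,
    im_integral_commutatorDensity hmd hf hfc hfW g (apply_zero_nonpos_of_tsupport hg)]
  simp

/-- The energy in the symbol and the `i` of the generator combine into minus the transform of the
time derivative of `f`, so causality applies to `timeDeriv f`. -/
theorem im_inner_derivSymbol [NeZero d] (hmd : 0 < m ∨ 2 ≤ d) {g : 𝓢(Space d, ℝ)}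
    (hg : tsupport g ⊆ (halfSpace d)ᶜ) {v : OneParticle d m}
    (hv : v ∈ testVectors d m (wedge d)) :
    (inner ℂ ((memLp_derivSymbol hmd g).toLp _) v).im = 0 := by
  obtain ⟨f, hf, hfc, hfW, hv⟩ := hv
  rw [eq_toLp_testFunction hmd hf hfc hv, inner_toLp]
  have e : ∀ p : Space d, ((1 / (2 * energy m p) : ℝ) : ℂ) *
      (testFunction f (event (energy m p) p) * conj (derivSymbol g (event (energy m p) p))) =
      ((-√(2 * Real.pi) : ℝ) : ℂ) * commutatorDensity m (timeDeriv f) g p := by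
    intro p
    simp only [derivSymbol, conj_conj, spatial_event, testFunction, commutatorDensity,
      lorentzFourier_timeDeriv hf hfc, event_zero]
    push_cast
    ring
  simp_rw [e]
  rw [integral_const_mul, im_ofReal_mul,
    im_integral_commutatorDensity hmd (contDiff_timeDeriv hf) (hasCompactSupport_timeDeriv hfc)
      ((tsupport_timeDeriv_subset f).trans hfW) g (apply_zero_nonpos_of_tsupport hg)]
  simp

theorem eq_zero_of_mem_localSubspace {O : Set (Spacetime d)} (ℓ : OneParticle d m →L[ℝ] ℝ)
    (h : ∀ v ∈ testVectors d m O, ℓ v = 0) {v : OneParticle d m} (hv : v ∈ localSubspace d m O) :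
    ℓ v = 0 := by
  have h1 : Submodule.span ℝ (testVectors d m O) ≤ LinearMap.ker ℓ.toLinearMap :=
    Submodule.span_le.2 h
  exact Submodule.topologicalClosure_minimal _ h1 ℓ.isClosed_ker hv

variable {Φ : 𝓢'(Spacetime d, ℂ)} {C : Spacetime d → ℂ}

theorem IsWave.memLp_posShell (h : IsWave m Φ C) : MemLp C 2 (posShell d m) :=
  h.memLp.mono_measure (Measure.le_add_right le_rfl)

theorem IsWave.vector_eq (h : IsWave m Φ C) :
    h.vector = ((√(2 * Real.pi) : ℝ) : ℂ) • h.memLp_posShell.toLp C := by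
  rw [← MemLp.toLp_const_smul]
  rfl

theorem dsupport_subset_of_mem [NeZero d] (hmd : 0 < m ∨ 2 ≤ d) (hΦ : IsWave m Φ C)
    (hv : hΦ.vector ∈ localSubspace d m (wedge d)) :
    Distribution.dsupport (cauchyValue m C) ⊆ halfSpace d ∧
      Distribution.dsupport (cauchyDeriv m C) ⊆ halfSpace d := by
  have h2 : √(2 * Real.pi) ≠ 0 := (Real.sqrt_pos.2 (by positivity)).ne'
  constructor
  · refine dsupport_subset_of_forall isClosed_halfSpace fun g hg => ?_
    have := eq_zero_of_mem_localSubspace (Complex.reCLM.comp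
      ((innerSL ℂ ((memLp_valueSymbol hmd g).toLp _)).restrictScalars ℝ))
      (fun v hv => re_inner_valueSymbol hmd hg hv) hv
    simp only [ContinuousLinearMap.comp_apply, ContinuousLinearMap.coe_restrictScalars',
      innerSL_apply_apply, reCLM_apply, hΦ.vector_eq, inner_smul_right, re_ofReal_mul,
      mul_eq_zero, h2, false_or] at this
    rw [cauchyValue_eq_inner hmd hΦ.memLp_posShell, this, mul_zero]
  · refine dsupport_subset_of_forall isClosed_halfSpace fun g hg => ?_
    have := eq_zero_of_mem_localSubspace (Complex.imCLM.comp
      ((innerSL ℂ ((memLp_derivSymbol hmd g).toLp _)).restrictScalars ℝ))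
      (fun v hv => im_inner_derivSymbol hmd hg hv) hv
    simp only [ContinuousLinearMap.comp_apply, ContinuousLinearMap.coe_restrictScalars',
      innerSL_apply_apply, imCLM_apply, hΦ.vector_eq, inner_smul_right, im_ofReal_mul,
      mul_eq_zero, h2, false_or] at this
    rw [cauchyDeriv_eq_inner hmd hΦ.memLp_posShell, this, mul_zero]

end Wedge

/-! ### Waves with localized Cauchy data are localized in the wedge -/

section Density

variable {d : ℕ} {m : ℝ}

/-- The Lorentz product carries `-𝐩·𝐱`, so the spatial transform of a spacetime test function is
evaluated at `-p`. -/
theorem IsMollifier.comp_neg {N : ℕ → Space d → ℂ} (hN : IsMollifier N) :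
    IsMollifier fun n p => N n (-p) :=
  ⟨fun n => (hN.continuous n).comp continuous_neg, fun n p => hN.norm_le_one n _,
    fun n => (hN.decay n).imp fun C hC p => by simpa using hC (-p), fun p => hN.tendsto _⟩

theorem spaceFourier_translate_mem {c x : Space d} {r : ℝ} {φ : Space d → ℝ} (h : IsBump c r φ) :
    ∃ g : 𝓢(Space d, ℝ), HasCompactSupport g ∧
      tsupport g ⊆ (fun y => y - x) ⁻¹' Metric.closedBall c r ∧
      ∀ p, spaceFourier g p = spaceFourier φ p * exp (I * (inner ℝ x p : ℂ)) := by
  have hcs : HasCompactSupport fun y => φ (y - x) :=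
    h.hasCompactSupport.comp_homeomorph (Homeomorph.subRight x)
  have hcd : ContDiff ℝ ∞ fun y => φ (y - x) := h.contDiff.comp (contDiff_id.sub contDiff_const)
  refine ⟨hcs.toSchwartzMap hcd, hcs, ?_, fun p => spaceFourier_comp_sub φ x p⟩
  refine closure_minimal (fun y hy => ?_) (Metric.isClosed_closedBall.preimage (by fun_prop))
  exact h.tsupport_subset (subset_tsupport _ hy)

/-- The test function with time profile `η` and space profile `φ`, translated by `x`. -/
def productTest (η : ℝ → ℝ) (φ : Space d → ℝ) (x : Space d) (k : Spacetime d) : ℝ :=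
  η (k 0) * φ (spatial d k - x)

theorem contDiff_productTest {c : Space d} {r s : ℝ} {η : ℝ → ℝ} {φ : Space d → ℝ}
    (hη : IsBump 0 s η) (hφ : IsBump c r φ) (x : Space d) :
    ContDiff ℝ ∞ (productTest η φ x) :=
  (hη.contDiff.comp (EuclideanSpace.proj (𝕜 := ℝ) (0 : Fin (d + 1))).contDiff).mul
    (hφ.contDiff.comp ((spatial d).contDiff.sub contDiff_const))

theorem tsupport_productTest {c : Space d} {r s : ℝ} {η : ℝ → ℝ} {φ : Space d → ℝ}
    (hη : IsBump 0 s η) (hφ : IsBump c r φ) (x : Space d) :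
    tsupport (productTest η φ x) ⊆
      {k | |k 0| ≤ s ∧ spatial d k - x ∈ Metric.closedBall c r} := by
  refine closure_minimal (fun k hk => ?_) ?_
  · have h1 : η (k 0) ≠ 0 := left_ne_zero_of_mul hk
    have h2 : φ (spatial d k - x) ≠ 0 := right_ne_zero_of_mul hk
    refine ⟨?_, hφ.tsupport_subset (subset_tsupport _ h2)⟩
    simpa using hη.tsupport_subset (subset_tsupport _ h1)
  · have h1 : IsClosed {k : Spacetime d | |k 0| ≤ s} := isClosed_le (by fun_prop) continuous_const
    have h2 : Continuous fun k => spatial d k - x := by fun_prop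
    exact h1.inter (Metric.isClosed_closedBall.preimage h2)

theorem hasCompactSupport_productTest {c : Space d} {r s : ℝ} {η : ℝ → ℝ} {φ : Space d → ℝ}
    (hη : IsBump 0 s η) (hφ : IsBump c r φ) (x : Space d) :
    HasCompactSupport (productTest η φ x) := by
  refine HasCompactSupport.of_support_subset_isCompact
    (((isCompact_Icc (a := -s) (b := s)).prod (isCompact_closedBall (c + x) r)).image
      continuous_event) fun k hk => ?_
  obtain ⟨h1, h2⟩ := tsupport_productTest hη hφ x (subset_tsupport _ hk)
  refine ⟨(k 0, spatial d k), ⟨abs_le.1 h1, ?_⟩, event_spatial k⟩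
  rw [Metric.mem_closedBall, dist_eq_norm] at h2 ⊢
  rwa [sub_add_eq_sub_sub_swap]

/-- The density `1/ω` is split evenly so that both factors are square integrable for Lebesgue
measure. -/
theorem inner_toLp_eq_integral_mul (V : OneParticle d m) {b : Spacetime d → ℂ}
    (hb : MemLp b 2 (posShell d m)) :
    inner ℂ V (hb.toLp b) = (1 / 2 : ℂ) * ∫ p : Space d,
      conj (V (event (energy m p) p) / (√(energy m p) : ℂ)) *
        (b (event (energy m p) p) / (√(energy m p) : ℂ)) := by
  have h := inner_toLp (Lp.memLp V) hb
  rw [Lp.toLp_coeFn] at h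
  rw [h, ← integral_const_mul]
  refine integral_congr_ae (.of_forall fun p => ?_)
  have h1 : (√(energy m p) : ℂ) * (√(energy m p) : ℂ) = energy m p := by
    exact_mod_cast Real.mul_self_sqrt (energy_nonneg m p)
  simp only [map_div₀, conj_ofReal]
  rw [div_mul_div_comm, h1]
  push_cast
  rw [one_div, one_div, mul_inv]
  ring

theorem fourierConst_pos (d : ℕ) : 0 < fourierConst d :=
  Real.rpow_pos_of_pos (by positivity) _

theorem abs_apply_zero_sub_le [NeZero d] {σ r : ℝ} {y : Space d}
    (hy : y ∈ Metric.closedBall (σ • EuclideanSpace.single 0 1) r) : |y 0 - σ| ≤ r := by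
  rw [Metric.mem_closedBall, dist_eq_norm] at hy
  have := (PiLp.norm_apply_le (y - σ • EuclideanSpace.single 0 1) 0).trans hy
  simpa using this

theorem sqrt_energy_mul_self (m : ℝ) (p : Space d) :
    (√(energy m p) : ℂ) * (√(energy m p) : ℂ) = energy m p := by
  exact_mod_cast Real.mul_self_sqrt (energy_nonneg m p)

/-! ### Vanishing conditions from the supports of the Cauchy data -/

section CauchyTest

variable [NeZero d] {C : Spacetime d → ℂ} {σ r : ℝ} {φ : Space d → ℝ}

theorem preimage_closedBall_subset (hσ : σ + r < 0) {x : Space d} (hx : x 0 ≤ 0) :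
    (fun y : Space d => y - x) ⁻¹' Metric.closedBall (σ • EuclideanSpace.single 0 1) r ⊆
      (halfSpace d)ᶜ := by
  intro y hy
  have hy' : y - x ∈ Metric.closedBall (σ • (EuclideanSpace.single 0 1 : Space d)) r := hy
  have h2 := abs_le.1 (abs_apply_zero_sub_le hy')
  rw [PiLp.sub_apply] at h2
  simp only [halfSpace, Set.mem_compl_iff, Set.mem_ofPred_eq, not_le]
  linarith [h2.2]

theorem re_integral_eq_zero_of_dsupport_cauchyValue (hmd : 0 < m ∨ 2 ≤ d)
    (hC : MemLp C 2 (posShell d m))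
    (h : Distribution.dsupport (cauchyValue m C) ⊆ halfSpace d)
    (hφ : IsBump (σ • EuclideanSpace.single 0 1) r φ) (hσ : σ + r < 0) {x : Space d}
    (hx : x 0 ≤ 0) :
    (∫ p : Space d, C (event (energy m p) p) / (√(energy m p) : ℂ) *
      (spaceFourier φ p / (√(energy m p) : ℂ) * exp (I * (inner ℝ x p : ℂ)))).re = 0 := by
  obtain ⟨g, hgc, hgs, hg⟩ := spaceFourier_translate_mem (x := x) hφ
  have h2 := eq_zero_of_disjoint_dsupport
    (AddMonoidHom.mk' (cauchyValue m C) (cauchyValue_add hmd hC)) hgc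
    (Set.disjoint_left.2 fun y hy hy' => preimage_closedBall_subset hσ hx (hgs hy) (h hy'))
  have h3 : fourierConst d *
    (∫ p : Space d, C (event (energy m p) p) * spaceFourier g p / (energy m p : ℂ)).re = 0 := h2
  rw [mul_eq_zero, or_iff_right (fourierConst_pos d).ne'] at h3
  rw [← h3]
  congr 1
  refine integral_congr_ae (.of_forall fun p => ?_)
  simp only [hg, ← sqrt_energy_mul_self m p]
  simp only [div_eq_mul_inv, mul_inv]
  ring

theorem im_integral_eq_zero_of_dsupport_cauchyDeriv (hmd : 0 < m ∨ 2 ≤ d)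
    (hC : MemLp C 2 (posShell d m))
    (h : Distribution.dsupport (cauchyDeriv m C) ⊆ halfSpace d)
    (hφ : IsBump (σ • EuclideanSpace.single 0 1) r φ) (hσ : σ + r < 0) {x : Space d}
    (hx : x 0 ≤ 0) :
    (∫ p : Space d, C (event (energy m p) p) / (√(energy m p) : ℂ) *
      (spaceFourier φ p * (√(energy m p) : ℂ) * exp (I * (inner ℝ x p : ℂ)))).im = 0 := by
  obtain ⟨g, hgc, hgs, hg⟩ := spaceFourier_translate_mem (x := x) hφ
  have h2 := eq_zero_of_disjoint_dsupport
    (AddMonoidHom.mk' (cauchyDeriv m C) (cauchyDeriv_add hmd hC)) hgc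
    (Set.disjoint_left.2 fun y hy hy' => preimage_closedBall_subset hσ hx (hgs hy) (h hy'))
  have h3 : fourierConst d *
    (∫ p : Space d, C (event (energy m p) p) * spaceFourier g p).im = 0 := h2
  rw [mul_eq_zero, or_iff_right (fourierConst_pos d).ne'] at h3
  rw [← h3]
  congr 1
  refine integral_congr_ae ?_
  filter_upwards [ae_energy_pos m] with p hp
  have hω : (√(energy m p) : ℂ) ≠ 0 := by exact_mod_cast (Real.sqrt_pos.2 hp).ne'
  rw [hg]
  field_simp

end CauchyTest

/-! ### Vanishing conditions from orthogonality to test functions in the wedge -/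

section WedgeTest

variable [NeZero d] {σ r s : ℝ} {η : ℝ → ℝ} {ψ : Space d → ℝ}

theorem tsupport_productTest_subset_wedge (hη : IsBump 0 s η)
    (hψ : IsBump (σ • EuclideanSpace.single 0 1) r ψ) (hσ : s < σ - r) {x : Space d}
    (hx : 0 ≤ x 0) : tsupport (productTest η ψ x) ⊆ wedge d := by
  intro k hk
  obtain ⟨h2, h3⟩ := tsupport_productTest hη hψ x hk
  have h4 := abs_le.1 (abs_apply_zero_sub_le h3)
  rw [PiLp.sub_apply, spatial_apply] at h4
  change |k 0| < k (Fin.succ 0)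
  linarith [h4.1]

theorem re_integral_testFunction_eq_zero (hmd : 0 < m ∨ 2 ≤ d) {V : OneParticle d m}
    (hV : ∀ v ∈ testVectors d m (wedge d), (inner ℂ V v).re = 0) {f : Spacetime d → ℝ}
    (hf : ContDiff ℝ ∞ f) (hfc : HasCompactSupport f) (hfW : tsupport f ⊆ wedge d) :
    (∫ p : Space d, conj (V (event (energy m p) p) / (√(energy m p) : ℂ)) *
      (testFunction f (event (energy m p) p) / (√(energy m p) : ℂ))).re = 0 := by
  have h2 := hV ((memLp_testFunction hmd hf hfc).toLp _)
    ⟨f, hf, hfc, hfW, MemLp.coeFn_toLp _⟩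
  rw [inner_toLp_eq_integral_mul] at h2
  have e : (1 / 2 : ℂ) = ((1 / 2 : ℝ) : ℂ) := by norm_num
  rw [e, re_ofReal_mul] at h2
  simpa using h2

/-- Orthogonality is tested on a product of a time bump and a translated space bump; the `i` of the
generator turns a real part into an imaginary one. -/
theorem im_integral_eq_zero_of_wedge (hmd : 0 < m ∨ 2 ≤ d) {V : OneParticle d m}
    (hV : ∀ v ∈ testVectors d m (wedge d), (inner ℂ V v).re = 0) (hη : IsBump 0 s η)
    (hψ : IsBump (σ • EuclideanSpace.single 0 1) r ψ) (hσ : s < σ - r) {x : Space d}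
    (hx : 0 ≤ x 0) :
    (∫ p : Space d, conj (V (event (energy m p) p) / (√(energy m p) : ℂ)) *
      (timeFourier η (energy m p) * spaceFourier ψ (-p) / (√(energy m p) : ℂ) *
        exp (-(I * (inner ℝ x p : ℂ))))).im = 0 := by
  have h2 := re_integral_testFunction_eq_zero hmd hV (contDiff_productTest hη hψ x)
    (hasCompactSupport_productTest hη hψ x) (tsupport_productTest_subset_wedge hη hψ hσ hx)
  have hpos : √(2 * Real.pi) * fourierConst d ≠ 0 := by
    have := fourierConst_pos d
    positivity
  have e : ∀ p : Space d, conj (V (event (energy m p) p) / (√(energy m p) : ℂ)) *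
      (testFunction (productTest η ψ x) (event (energy m p) p) / (√(energy m p) : ℂ)) =
      ((√(2 * Real.pi) * fourierConst d : ℝ) : ℂ) * (I *
      (conj (V (event (energy m p) p) / (√(energy m p) : ℂ)) *
        (timeFourier η (energy m p) * spaceFourier ψ (-p) / (√(energy m p) : ℂ) *
        exp (-(I * (inner ℝ x p : ℂ)))))) := by
    intro p
    have hval := lorentzFourier_mul η ψ x (energy m p) p
    rw [testFunction]
    unfold productTest
    rw [hval]
    push_cast
    ring
  simp_rw [e] at h2
  rw [integral_const_mul, integral_const_mul, re_ofReal_mul, I_mul_re, mul_neg, neg_eq_zero,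
    mul_eq_zero, or_iff_right hpos] at h2
  exact h2

/-- The time derivative of the same product contributes `-iω · i = ω`, and `ω/√ω = √ω`. -/
theorem re_integral_eq_zero_of_wedge (hmd : 0 < m ∨ 2 ≤ d) {V : OneParticle d m}
    (hV : ∀ v ∈ testVectors d m (wedge d), (inner ℂ V v).re = 0) (hη : IsBump 0 s η)
    (hψ : IsBump (σ • EuclideanSpace.single 0 1) r ψ) (hσ : s < σ - r) {x : Space d}
    (hx : 0 ≤ x 0) :
    (∫ p : Space d, conj (V (event (energy m p) p) / (√(energy m p) : ℂ)) *
      (timeFourier η (energy m p) * spaceFourier ψ (-p) * (√(energy m p) : ℂ) *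
        exp (-(I * (inner ℝ x p : ℂ))))).re = 0 := by
  have hf := contDiff_productTest hη hψ x
  have hfc := hasCompactSupport_productTest hη hψ x
  have h2 := re_integral_testFunction_eq_zero hmd hV (contDiff_timeDeriv hf)
    (hasCompactSupport_timeDeriv hfc)
    ((tsupport_timeDeriv_subset _).trans (tsupport_productTest_subset_wedge hη hψ hσ hx))
  have hpos : √(2 * Real.pi) * fourierConst d ≠ 0 := by
    have := fourierConst_pos d
    positivity
  have e : ∀ p : Space d, conj (V (event (energy m p) p) / (√(energy m p) : ℂ)) *
      (testFunction (timeDeriv (productTest η ψ x)) (event (energy m p) p) /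
        (√(energy m p) : ℂ)) =
      ((√(2 * Real.pi) * fourierConst d : ℝ) : ℂ) *
      (conj (V (event (energy m p) p) / (√(energy m p) : ℂ)) *
        (timeFourier η (energy m p) * spaceFourier ψ (-p) * (√(energy m p) : ℂ) *
        exp (-(I * (inner ℝ x p : ℂ))))) := by
    intro p
    have h3 : (energy m p : ℂ) / (√(energy m p) : ℂ) = (√(energy m p) : ℂ) := by
      exact_mod_cast Real.div_sqrt
    have hval : lorentzFourier (fun k => (productTest η ψ x k : ℂ)) (event (energy m p) p) = _ :=
      lorentzFourier_mul η ψ x (energy m p) p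
    rw [testFunction, lorentzFourier_timeDeriv hf hfc, hval, event_zero]
    generalize conj (V (event (energy m p) p) / (√(energy m p) : ℂ)) = w
    generalize timeFourier η (energy m p) * spaceFourier ψ (-p) = M
    generalize exp (-(I * (inner ℝ x p : ℂ))) = E
    push_cast
    linear_combination (-(w * √(2 * Real.pi) * fourierConst d * M * E *
      (energy m p / √(energy m p)))) * I_mul_I + w * √(2 * Real.pi) * fourierConst d * M * E * h3
  simp_rw [e] at h2
  rw [integral_const_mul, re_ofReal_mul, mul_eq_zero, or_iff_right hpos] at h2
  exact h2

end WedgeTest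

/-- A vector that is real orthogonal to the vectors localized in the wedge is real orthogonal to the
waves whose Cauchy data are localized in the half-space. -/
theorem re_inner_eq_zero_of_dsupport [NeZero d] (hmd : 0 < m ∨ 2 ≤ d) {C : Spacetime d → ℂ}
    (hCm : Measurable C) (hC : MemLp C 2 (posShell d m))
    (h0 : Distribution.dsupport (cauchyValue m C) ⊆ halfSpace d)
    (h1 : Distribution.dsupport (cauchyDeriv m C) ⊆ halfSpace d) (V : OneParticle d m)
    (hV : ∀ v ∈ testVectors d m (wedge d), (inner ℂ V v).re = 0) :
    (inner ℂ V (hC.toLp C)).re = 0 := by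
  let r : ℕ → ℝ := fun n => 1 / ((n : ℝ) + 1)
  have hr : ∀ n, 0 < r n := fun n => by positivity
  have hrlim : Tendsto r atTop (𝓝 0) := tendsto_one_div_add_atTop_nhds_zero_nat
  have hclim : ∀ σ : ℝ, |σ| = 1 → Tendsto
      (fun n => ‖(σ * (2 * r n)) • (EuclideanSpace.single 0 1 : Space d)‖ + r n) atTop (𝓝 0) := by
    intro σ hσ
    have : ∀ n, ‖(σ * (2 * r n)) • (EuclideanSpace.single 0 1 : Space d)‖ + r n = 3 * r n := by
      intro n
      rw [norm_smul, PiLp.norm_single, norm_one, Real.norm_eq_abs, abs_mul, hσ,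
        abs_of_pos (mul_pos two_pos (hr n))]
      ring
    simp_rw [this]
    simpa using hrlim.const_mul 3
  -- The ball of radius `r` about `-2r e₁` lies in `x₁ ≤ -r`, off the half-space. The one about `2r
  -- e₁` lies in `x₁ ≥ r`, beyond the half-width `r/2` of the time bump, so the product lies in the
  -- wedge.
  choose φ hφ using fun n =>
    exists_isBump ((-1 * (2 * r n)) • (EuclideanSpace.single 0 1 : Space d)) (hr n)
  choose ψ hψ using fun n =>
    exists_isBump ((1 * (2 * r n)) • (EuclideanSpace.single 0 1 : Space d)) (hr n)
  choose η hη using fun n => exists_isBump (0 : ℝ) (half_pos (hr n))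
  have hσ : ∀ n, -1 * (2 * r n) + r n < 0 := fun n => by have := hr n; linarith
  have hσ' : ∀ n, r n / 2 < 1 * (2 * r n) - r n := fun n => by have := hr n; linarith
  have hN := isMollifier_spaceFourier hφ (hclim _ (by simp))
  have hM : IsMollifier fun n p => timeFourier (η n) (energy m p) * spaceFourier (ψ n) (-p) :=
    (isMollifier_spaceFourier hψ (hclim _ (by simp))).comp_neg.timeFourier_mul hη
      (by simpa using hrlim.div_const 2)
  have hN' : ∀ n, reflect (spaceFourier (φ n)) = spaceFourier (φ n) := by
    intro n; funext p; rw [reflect, spaceFourier_neg, conj_conj]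
  have hM' : ∀ n, reflect (fun p => timeFourier (η n) (energy m p) * spaceFourier (ψ n) (-p)) =
      fun p => timeFourier (η n) (energy m p) * spaceFourier (ψ n) (-p) := by
    intro n; funext p
    simp only [reflect, map_mul, energy_neg, conj_timeFourier (hη n), spaceFourier_neg, conj_conj]
  have hu2 : MemLp (fun p : Space d =>
      conj (V (event (energy m p) p) / (√(energy m p) : ℂ))) 2 :=
    (memLp_div_sqrt_energy (Lp.stronglyMeasurable V).measurable (Lp.memLp V)).star
  have key := re_integral_mul_eq_zero_of_halfSpaces hmd hN hM hN' hM'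
    (memLp_div_sqrt_energy hCm hC) hu2
    (fun n x hx => re_integral_eq_zero_of_dsupport_cauchyValue hmd hC h0 (hφ n) (hσ n) hx)
    (fun n x hx => im_integral_eq_zero_of_dsupport_cauchyDeriv hmd hC h1 (hφ n) (hσ n) hx)
    (fun n x hx => im_integral_eq_zero_of_wedge hmd hV (hη n) (hψ n) (hσ' n) hx)
    (fun n x hx => re_integral_eq_zero_of_wedge hmd hV (hη n) (hψ n) (hσ' n) hx)
  have e : (1 / 2 : ℂ) = ((1 / 2 : ℝ) : ℂ) := by norm_num
  rw [inner_toLp_eq_integral_mul, e, re_ofReal_mul, key, mul_zero]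

/-- A vector belongs to a local subspace if it is real orthogonal to every vector that is real
orthogonal to the test vectors. -/
theorem mem_localSubspace_of_re_inner {O : Set (Spacetime d)} {c : OneParticle d m}
    (h : ∀ V : OneParticle d m, (∀ v ∈ testVectors d m O, (inner ℂ V v).re = 0) →
      (inner ℂ V c).re = 0) : c ∈ localSubspace d m O := by
  by_contra hc
  obtain ⟨ℓ, u, hu, huc⟩ := RCLike.geometric_hahn_banach_closed_point (𝕜 := ℂ)
    (localSubspace d m O).convex (Submodule.isClosed_topologicalClosure _) hc
  have hu0 : 0 < u := by simpa using hu 0 (zero_mem _)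
  have hz : ∀ v ∈ localSubspace d m O, (ℓ v).re = 0 := by
    intro v hv
    by_contra hne
    -- A real functional bounded above on a subspace vanishes there: rescaling `v` to reach the
    -- value `u` contradicts the strict bound.
    have h2 := hu ((u / (ℓ v).re) • v) (Submodule.smul_mem _ _ hv)
    rw [ContinuousLinearMap.map_smul_of_tower, RCLike.re_eq_complex_re, smul_re, smul_eq_mul,
      div_mul_cancel₀ _ hne] at h2
    exact lt_irrefl _ h2
  have h3 := h ((InnerProductSpace.toDual ℂ _).symm ℓ) fun v hv => by
    rw [InnerProductSpace.toDual_symm_apply]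
    exact hz v (Submodule.le_topologicalClosure _ (Submodule.subset_span hv))
  rw [InnerProductSpace.toDual_symm_apply] at h3
  rw [RCLike.re_eq_complex_re, h3] at huc
  exact lt_asymm hu0 huc

end Density

end KleinGordon

end

theorem proposition3p2 {d : ℕ} [NeZero d] {m : ℝ} (hm : 0 ≤ m) (hmd : 0 < m ∨ 2 ≤ d)
    {Φ : 𝓢'(Spacetime d, ℂ)} {C : Spacetime d → ℂ} (hΦ : IsWave m Φ C) :
    hΦ.vector ∈ localSubspace d m (wedge d) ↔
      Distribution.dsupport (cauchyValue m C) ⊆ halfSpace d ∧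
      Distribution.dsupport (cauchyDeriv m C) ⊆ halfSpace d := by
  refine ⟨dsupport_subset_of_mem hmd hΦ, fun ⟨h0, h1⟩ => ?_⟩
  refine mem_localSubspace_of_re_inner fun V hV => ?_
  rw [hΦ.vector_eq, inner_smul_right, Complex.re_ofReal_mul,
    re_inner_eq_zero_of_dsupport hmd hΦ.borel hΦ.memLp_posShell h0 h1 V hV, mul_zero]
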